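/- Let $G$ be a finite connected multigraph with vertex set $V$ and line set $E$, without loops (parallel lines are allowed), in which every vertex is an endpoint of at least two different lines. Fix an orientation of each line and put $s^v_i=+1$ if line $i$ is oriented into the vertex $v$, $s^v_i=-1$ if it is oriented away from $v$, and $s^v_i=0$ otherwise. Let $(N_v)_{v\in V}$ be integers with $\sum_v N_v=0$, and let $q=(q_i)_{i\in E}$ be positive real variables. The Matsubara integral $I_G(q)=I_G(\{N_v\},\{q_i\})$ is the integral of $\prod_{i\in E}\frac{1}{x_i^2+q_i^2}$ over all real $x=(x_i)_{i\in E}$ satisfying the constraints $\sum_i s^v_i x_i=N_v$ for all $v\in V$. Here, for a spanning tree $\mathcal T$ of $G$, the constraints are used to express the variables $x_j$, $j\in\mathcal T$, through the remaining variables $x_l$, $l\in E\setminus\mathcal T$, and one integrates over the latter with respect to Lebesgue measure on $\mathbb R^{E\setminus\mathcal T}$. On the field $\mathbb C(q_i:i\in E)$ of rational functions let $\hat R_i$ be the reflection operator that replaces $q_i$ by $-q_i$ and fixes the other variables. A cutset of $G$ is a set $C$ of lines whose removal (keeping all vertices) leaves a disconnected graph. Then: 1. For every spanning tree $\mathcal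 T$ and all real values of $(x_l)_{l\notin\mathcal T}$ the constraints have exactly one solution $x$ with these values, and for every $q$ with all $q_i>0$ the integral over $(x_l)_{l\notin\mathcal T}$ converges absolutely. 2. There is exactly one rational function $F\in\mathbb C(q_i:i\in E)$ that evaluates $I_G$, in the following sense: whichever spanning tree is used to compute $I_G$, and for any polynomials $P,Q$ with $Q\neq0$ and $F=P/Q$, one has $Q(q)\,I_G(q)=P(q)$ for all $q$ with all $q_i>0$. 3. For every cutset $C$ of $G$ the operator $\hat{\mathcal A}_C=\prod_{i\in C}(1-\hat R_i)$ annihilates the Matsubara integral: $\hat{\mathcal A}_C F=0$, where $F$ is the rational function of part 2. -/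

import Mathlib

open MeasureTheory

noncomputable section

/-- A multigraph with vertex type `V` and line type `E` in which every line carries a (freely
chosen) orientation, from `src e` to `tgt e`. -/
structure OrientedMultigraph (V E : Type*) where
  src : E → V
  tgt : E → V

namespace OrientedMultigraph

variable {V E : Type*} [Fintype V] [DecidableEq V] [Fintype E] [DecidableEq E]

/-- The adjacency relation on the whole vertex set `V` generated by the lines in `S`. -/
def spanned (G : OrientedMultigraph V E) (S : Finset E) : SimpleGraph V :=
  SimpleGraph.fromRel fun u v => ∃ e ∈ S, G.src e = u ∧ G.tgt e = v

/-- Connected, without loops, every vertex being an endpoint of at least two different lines;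
parallel lines are allowed. -/
structure IsMatsubara (G : OrientedMultigraph V E) : Prop where
  connected : (G.spanned Finset.univ).Connected
  loopless : ∀ e, G.src e ≠ G.tgt e
  two_le_degree : ∀ v, 2 ≤ (Finset.univ.filter fun e => G.src e = v ∨ G.tgt e = v).card

/-- A set of lines whose removal (keeping all vertices) leaves a disconnected graph. -/
def IsCutset (G : OrientedMultigraph V E) (C : Finset E) : Prop :=
  ¬ (G.spanned Cᶜ).Connected

/-- A set of lines that joins all vertices into a connected graph with no cycles. Two parallel
lines form a cycle, which the underlying simple graph does not see; the second clause excludes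
them. -/
structure IsSpanningTree (G : OrientedMultigraph V E) (T : Finset E) : Prop where
  isTree : (G.spanned T).IsTree
  noParallel : Set.InjOn (fun e => s(G.src e, G.tgt e)) (T : Set E)

/-- The incidence sign: `+1` if `e` is oriented into `v`, `-1` if it is oriented away from `v`,
`0` if it is not incident on `v` (for a graph without loops). -/
def sign (G : OrientedMultigraph V E) (v : V) (e : E) : ℝ :=
  if G.tgt e = v then 1 else if G.src e = v then -1 else 0

/-- The constraints `T_v = N_v` at all vertices, where `T_v` is the signed sum of the line
variables at `v`. -/
def Conserves (G : OrientedMultigraph V E) (N : V → ℤ) (x : E → ℝ) : Prop :=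
  ∀ v, ∑ e, G.sign v e * x e = (N v : ℝ)

open Classical in
/-- The values of all line variables, obtained by solving the vertex constraints in terms of
the independent variables `y` attached to the lines outside the spanning tree `T`. -/
def solve (G : OrientedMultigraph V E) (N : V → ℤ) (T : Finset E)
    (y : {e // e ∉ T} → ℝ) : E → ℝ :=
  if h : ∃ x : E → ℝ, G.Conserves N x ∧ ∀ l : {e // e ∉ T}, x l = y l then h.choose else 0

/-- The integrand `∏ᵢ 1 / (xᵢ² + qᵢ²)` on the solutions of the vertex constraints. -/
def integrand (G : OrientedMultigraph V E) (N : V → ℤ) (T : Finset E) (q : E → ℝ)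
    (y : {e // e ∉ T} → ℝ) : ℝ :=
  ∏ i, 1 / (G.solve N T y i ^ 2 + q i ^ 2)

/-- The Matsubara integral: the delta functions at the vertices are used to eliminate the
variables of the lines of `T`, and one integrates over the remaining real variables. -/
def matsubaraIntegral (G : OrientedMultigraph V E) (N : V → ℤ) (T : Finset E)
    (q : E → ℝ) : ℝ :=
  ∫ y, G.integrand N T q y

end OrientedMultigraph

section Reflections

variable {E : Type*} [DecidableEq E]

/-- The field `ℂ(q_i : i ∈ E)` of rational functions in the line variables. -/
abbrev LineRatFunc (E : Type*) : Type _ := FractionRing (MvPolynomial E ℂ)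

/-- The substitution `q_i ↦ -q_i` on polynomials. -/
def reflectPolyHom (i : E) : MvPolynomial E ℂ →ₐ[ℂ] MvPolynomial E ℂ :=
  MvPolynomial.aeval fun j => if j = i then -MvPolynomial.X j else MvPolynomial.X j

theorem reflectPolyHom_comm (i k : E) :
    (reflectPolyHom i).comp (reflectPolyHom k) = (reflectPolyHom k).comp (reflectPolyHom i) := by
  ext1 j
  have h (i j : E) : reflectPolyHom i (MvPolynomial.X j) =
      if j = i then -MvPolynomial.X j else MvPolynomial.X j := by
    simp [reflectPolyHom]
  rw [AlgHom.comp_apply, AlgHom.comp_apply, h k j, h i j]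
  by_cases h1 : j = i
  · by_cases h2 : j = k
    · rw [if_pos h1, if_pos h2, map_neg, map_neg, h i j, h k j, if_pos h1, if_pos h2]
    · rw [if_pos h1, if_neg h2, map_neg, h i j, h k j, if_pos h1, if_neg h2]
  · by_cases h2 : j = k
    · rw [if_neg h1, if_pos h2, map_neg, h i j, h k j, if_neg h1, if_pos h2]
    · rw [if_neg h1, if_neg h2, h i j, h k j, if_neg h1, if_neg h2]

theorem reflectPolyHom_self (i : E) :
    (reflectPolyHom i).comp (reflectPolyHom i) = AlgHom.id ℂ _ := by
  ext1 j
  by_cases h1 : j = i <;> simp [reflectPolyHom, h1]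

/-- The substitution `q_i ↦ -q_i` on polynomials, as an automorphism. -/
def reflectPoly (i : E) : MvPolynomial E ℂ ≃ₐ[ℂ] MvPolynomial E ℂ :=
  AlgEquiv.ofAlgHom (reflectPolyHom i) (reflectPolyHom i)
    (reflectPolyHom_self i) (reflectPolyHom_self i)

/-- The reflection operator `R̂ᵢ`: the substitution `q_i ↦ -q_i` on rational functions. -/
def reflection (i : E) : Module.End ℂ (LineRatFunc E) :=
  (IsFractionRing.algEquivOfAlgEquiv (K := LineRatFunc E) (L := LineRatFunc E)
    (reflectPoly i)).toLinearMap

theorem reflection_div (i : E) (P Q : MvPolynomial E ℂ) :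
    reflection i (algebraMap _ (LineRatFunc E) P / algebraMap _ (LineRatFunc E) Q) =
      algebraMap _ (LineRatFunc E) (reflectPolyHom i P) /
        algebraMap _ (LineRatFunc E) (reflectPolyHom i Q) := by
  simp [reflection, reflectPoly]

theorem reflection_commute (i k : E) : Commute (reflection i) (reflection k) := by
  refine LinearMap.ext fun F => ?_
  obtain ⟨P, Q, -, rfl⟩ := IsFractionRing.div_surjective (A := MvPolynomial E ℂ) F
  have h := fun P => DFunLike.congr_fun (reflectPolyHom_comm i k) P
  simp only [AlgHom.comp_apply] at h
  simp only [Module.End.mul_apply, reflection_div, h]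

/-- The operator `∏_{i ∈ C} (1 - R̂ᵢ)`; its factors commute. -/
def cutOperator (C : Finset E) : Module.End ℂ (LineRatFunc E) :=
  C.noncommProd (fun i => 1 - reflection i) fun i _ k _ _ =>
    ((Commute.one_left _).sub_left
      ((Commute.one_right _).sub_right (reflection_commute i k)))

/-- `F` and the real function `f` agree on the positive orthant: if `F = P / Q` in any way as a
quotient of polynomials, then `Q(q) f(q) = P(q)` at every point `q` with positive coordinates. -/
def AgreesOnPositive (F : LineRatFunc E) (f : (E → ℝ) → ℝ) : Prop :=
  ∀ P Q : MvPolynomial E ℂ, Q ≠ 0 →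
    F = algebraMap _ (LineRatFunc E) P / algebraMap _ (LineRatFunc E) Q →
    ∀ q : E → ℝ, (∀ i, 0 < q i) →
      MvPolynomial.eval (fun i => (q i : ℂ)) Q * (f q : ℂ) =
        MvPolynomial.eval (fun i => (q i : ℂ)) P

end Reflections

/-- `F` is the evaluation of the Matsubara integral as a rational function of the line variables:
it agrees with the integral, computed with any spanning tree, at all positive values of them. -/
def OrientedMultigraph.IsEvaluation {V E : Type*} [Fintype V] [DecidableEq V] [Fintype E]
    [DecidableEq E] (G : OrientedMultigraph V E) (N : V → ℤ) (F : LineRatFunc E) : Prop :=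
  ∀ T : Finset E, G.IsSpanningTree T → AgreesOnPositive F (G.matsubaraIntegral N T)

end

/-! Fix a spanning tree `T`. Summing the constraints over one side of the fundamental cut of a tree
line `j` writes `x_j` as an affine function, with integer coefficients, of the `x_l` with `l ∉ T`.
Up to `π / q_l`, the factors `1 / (x_l² + q_l²)` with `l ∉ T` are Cauchy densities. So the integral
is `∏ π / q_l` times the mean of `∏_{j ∈ T} 1 / (x_j² + q_j²)` over independent Cauchy variables
`y_l` of scales `q_l` (`matsubaraIntegral_eq_cauchyMean`). Putting `z_j = q_j` on the tree and `z_l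
= i y_l` off it, each tree factor is a product of two inverse affine forms `1 / (z_j ± (∑ m_l z_l +
i n))`, both with positive real part.

Averages are computed one variable at a time. By partial fractions (`exchange_invForms`,
`exists_add_of_exchange`), `f = a + b`, where the forms inverted in `a` have coefficient `≥ 0` at
`z_l` and those in `b` coefficient `≤ 0`. Then `a` is bounded and holomorphic for `Re z_l > 0`, and
its Cauchy average is its value at `z_l = q_l`; for `b` one reflects first. The average is thus the
rational function `g = a + R_l b`, and `g + R_l g = f + R_l f` (`exists_cauchy_average`). The
denominators of `g` are of the same kind, so the step iterates and yields `F`. Independence of the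
tree is a unimodular change of variables (`matsubaraIntegral_eq`), and uniqueness holds because
polynomials are determined on the positive orthant.

For the cutset identity, `1 / z_l` is odd, so `(1 - R_l)(g / z_l) = (1 + R_l) g / z_l = (1 + R_l) f
/ z_l`: the cut operator undoes the averaging. It suffices to treat a minimal cutset `{c} ∪ K`, with
a tree meeting it only in `c`. Then `x_c` depends only on the `x_l` with `l ∈ K`. Averaging the
remaining tree factors over the lines outside `T ∪ K` gives a function `χ` free of `z_c`. Applying
`∏_{l ∈ K} (1 - R_l)` to `F` leaves the loop factor times `∏_{l ∈ K} (1 + R_l)(γ χ)`, where `γ` is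
the factor of `c`. This is even in `z_c`, so `1 - R_c` kills it
(`exists_evaluation_cutOperator_eq_zero`). -/

noncomputable section

set_option linter.unusedSectionVars false

/-! ### Cauchy averages of boundary values of functions holomorphic in a half-plane. -/

section CauchyLaw

open ProbabilityTheory Complex

/-- The centred Cauchy law of scale `q`. -/
def cauchyLaw (q : ℝ) : Measure ℝ := cauchyMeasure 0 q.toNNReal

instance (q : ℝ) : IsProbabilityMeasure (cauchyLaw q) := by
  unfold cauchyLaw; infer_instance

theorem cauchyLaw_eq {q : ℝ} (hq : 0 < q) :
    cauchyLaw q = volume.withDensity fun t => ENNReal.ofReal (q / Real.pi * (1 / (t ^ 2 + q ^ 2))) := by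
  have h : q.toNNReal ≠ 0 := by simpa using hq
  rw [cauchyLaw, cauchyMeasure_of_scale_ne_zero _ h]
  congr 1
  funext t
  rw [cauchyPDF_def, cauchyPDFReal_def, Real.coe_toNNReal _ hq.le, sub_zero]
  congr 1
  ring

theorem integral_cauchyLaw {q : ℝ} (hq : 0 < q) (f : ℝ → ℂ) :
    ∫ t, f t ∂cauchyLaw q = ∫ t, ((q / Real.pi * (1 / (t ^ 2 + q ^ 2)) : ℝ) : ℂ) * f t := by
  rw [cauchyLaw_eq hq, integral_withDensity_eq_integral_toReal_smul (by fun_prop)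
    (Filter.Eventually.of_forall fun _ => ENNReal.ofReal_lt_top)]
  refine integral_congr_ae (Filter.Eventually.of_forall fun t => ?_)
  simp only
  rw [ENNReal.toReal_ofReal (by positivity), real_smul]

theorem integral_comp_neg_cauchyLaw {q : ℝ} (hq : 0 < q) (f : ℝ → ℂ) :
    ∫ t, f (-t) ∂cauchyLaw q = ∫ t, f t ∂cauchyLaw q := by
  rw [integral_cauchyLaw hq, integral_cauchyLaw hq, ← integral_neg_eq_self]
  simp

theorem integrable_lorentzian {q : ℝ} (hq : 0 < q) :
    Integrable fun t : ℝ => 1 / (t ^ 2 + q ^ 2) := by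
  have h := (integrable_cauchyPDFReal 0 (γ := q.toNNReal)).const_mul (Real.pi / q)
  refine h.congr (Filter.Eventually.of_forall fun t => ?_)
  simp only [cauchyPDFReal_def, Real.coe_toNNReal _ hq.le]
  have := Real.pi_pos
  field_simp
  simp

theorem integrable_exp_neg_abs {q : ℝ} (hq : 0 < q) :
    Integrable fun x : ℝ => cexp (-q * |x|) := by
  rw [← integrableOn_univ, ← Set.Iic_union_Ioi (a := (0 : ℝ)), integrableOn_union]
  constructor
  · refine (integrableOn_exp_mul_complex_Iic (a := q) (by simpa using hq) 0).congr_fun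
      (fun x hx => ?_) measurableSet_Iic
    simp [abs_of_nonpos (Set.mem_Iic.1 hx)]
  · refine (integrableOn_exp_mul_complex_Ioi (a := -q) (by simpa using hq) 0).congr_fun
      (fun x hx => ?_) measurableSet_Ioi
    simp [abs_of_pos (Set.mem_Ioi.1 hx)]

theorem integral_exp_neg_abs {q : ℝ} (hq : 0 < q) (w : ℝ) :
    ∫ x : ℝ, cexp (-(w * x) * I) * cexp (-q * |x|) = 2 * q / (q ^ 2 + w ^ 2) := by
  have hint : Integrable fun x : ℝ => cexp (-(w * x) * I) * cexp (-q * |x|) := by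
    refine (integrable_exp_neg_abs hq).bdd_mul (c := 1) (by fun_prop) ?_
    refine Filter.Eventually.of_forall fun x => ?_
    have := norm_exp_ofReal_mul_I (-(w * x))
    push_cast at this
    rw [this]
  rw [← integral_add_compl measurableSet_Iic hint (s := Set.Iic (0 : ℝ)), Set.compl_Iic]
  have h1 : ∫ x in Set.Iic (0 : ℝ), cexp (-(w * x) * I) * cexp (-q * |x|) = 1 / (q - w * I) := by
    rw [setIntegral_congr_fun (g := fun x : ℝ => cexp ((q - w * I) * x)) measurableSet_Iic,
      integral_exp_mul_complex_Iic (by simpa using hq)]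
    · simp
    · intro x hx
      simp only [abs_of_nonpos (Set.mem_Iic.1 hx), ← Complex.exp_add]
      congr 1
      push_cast
      ring
  have h2 : ∫ x in Set.Ioi (0 : ℝ), cexp (-(w * x) * I) * cexp (-q * |x|) = 1 / (q + w * I) := by
    rw [setIntegral_congr_fun (g := fun x : ℝ => cexp ((-(q + w * I)) * x)) measurableSet_Ioi,
      integral_exp_mul_complex_Ioi (by simpa using hq)]
    · simp [neg_div]
      rw [← neg_add_rev, inv_neg, neg_neg, add_comm]
    · intro x hx
      simp only [abs_of_pos (Set.mem_Ioi.1 hx), ← Complex.exp_add]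
      congr 1
      ring
  have n1 : (q - w * I : ℂ) ≠ 0 := fun h => hq.ne' (by simpa using congrArg re h)
  have n2 : (q + w * I : ℂ) ≠ 0 := fun h => hq.ne' (by simpa using congrArg re h)
  have n3 : (q ^ 2 + w ^ 2 : ℂ) = (q - w * I) * (q + w * I) := by
    linear_combination (w ^ 2 : ℂ) * I_sq
  rw [h1, h2, n3]
  field_simp
  ring

/-- Fourier inversion for `exp (-q |x|)`, whose transform is a Lorentzian: after rescaling by `2π`,
the inversion integral at `-s` is the integral against the Cauchy density. -/
theorem integral_exp_cauchyLaw {q : ℝ} (hq : 0 < q) {s : ℝ} (hs : 0 ≤ s) :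
    ∫ t, cexp (-(s * t) * I) ∂cauchyLaw q = cexp (-(q * s)) := by
  set f : ℝ → ℂ := fun x => cexp (-q * |x|)
  have hF : FourierTransform.fourier f = fun v : ℝ => (((2 * q * (1 / ((2 * Real.pi * v) ^ 2 + q ^ 2)) : ℝ)) : ℂ) := by
    funext v
    rw [Real.fourier_eq']
    have := integral_exp_neg_abs hq (2 * Real.pi * v)
    push_cast at this ⊢
    rw [mul_one_div, add_comm (_ ^ 2 : ℂ), ← this]
    refine integral_congr_ae (Filter.Eventually.of_forall fun x => ?_)
    simp [f]
    congr 1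
    ring
  have hFi : Integrable (FourierTransform.fourier f) := by
    rw [hF]
    refine Integrable.ofReal (Integrable.const_mul ?_ _)
    exact (integrable_lorentzian hq).comp_mul_left' (R := 2 * Real.pi) (by positivity)
  have hc : Continuous f := by fun_prop
  have key := congrFun (hc.fourierInv_fourier_eq (integrable_exp_neg_abs hq) hFi) (-s)
  rw [Real.fourierInv_eq', hF] at key
  have hfs : f (-s) = cexp (-(q * s)) := by
    simp [f, abs_of_nonneg hs]
  rw [← hfs, ← key, integral_cauchyLaw hq]
  have hsub := Measure.integral_comp_mul_left
    (fun t : ℝ => ((q / Real.pi * (1 / (t ^ 2 + q ^ 2)) : ℝ) : ℂ) * cexp (-(s * t) * I)) (2 * Real.pi)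
  have hpi : (Real.pi : ℂ) ≠ 0 := by exact_mod_cast Real.pi_ne_zero
  rw [eq_comm, abs_of_pos (by positivity), inv_smul_eq_iff₀ (by positivity)] at hsub
  rw [hsub, ← integral_smul]
  refine integral_congr_ae (Filter.Eventually.of_forall fun x => ?_)
  simp
  have e : -(s * (2 * Real.pi * x) * I) = -(2 * Real.pi * (s * x) * I) := by ring
  rw [e, mul_comm (cexp _)]
  field_simp

/-- A bounded continuous function on the line whose Cauchy averages against the characters of
nonpositive frequency are those of a bounded holomorphic function on the right half-plane with
value `v` at `q`. -/
structure HasHardyValue (q : ℝ) (f : ℝ → ℂ) (v : ℂ) : Prop where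
  continuous : Continuous f
  bounded : ∃ c, ∀ t, ‖f t‖ ≤ c
  integral_eq : ∀ s : ℝ, 0 ≤ s →
    ∫ t, cexp (-(s * t) * I) * f t ∂cauchyLaw q = cexp (-(q * s)) * v

theorem norm_exp_neg_mul_I (s t : ℝ) : ‖cexp (-(s * t) * I)‖ = 1 := by
  have := norm_exp_ofReal_mul_I (-(s * t))
  push_cast at this
  exact this

namespace HasHardyValue

variable {q : ℝ} {f g : ℝ → ℂ} {v w : ℂ}

theorem integrable (h : HasHardyValue q f v) (s : ℝ) :
    Integrable (fun t : ℝ => cexp (-(s * t) * I) * f t) (cauchyLaw q) := by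
  obtain ⟨c, hc⟩ := h.bounded
  have := h.continuous
  refine Integrable.of_bound (C := c) (by fun_prop) (Filter.Eventually.of_forall fun t => ?_)
  rw [norm_mul, norm_exp_neg_mul_I, one_mul]
  exact hc t

theorem integrable_comp_neg (h : HasHardyValue q f v) :
    Integrable (fun t : ℝ => f (-t)) (cauchyLaw q) := by
  obtain ⟨c, hc⟩ := h.bounded
  have := h.continuous
  exact Integrable.of_bound (C := c) (by fun_prop) (Filter.Eventually.of_forall fun t => hc _)

theorem const (hq : 0 < q) (c : ℂ) : HasHardyValue q (fun _ => c) c where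
  continuous := continuous_const
  bounded := ⟨‖c‖, fun _ => le_rfl⟩
  integral_eq s hs := by rw [integral_mul_const, integral_exp_cauchyLaw hq hs]

theorem add (hf : HasHardyValue q f v) (hg : HasHardyValue q g w) :
    HasHardyValue q (fun t => f t + g t) (v + w) where
  continuous := hf.continuous.add hg.continuous
  bounded := by
    obtain ⟨c, hc⟩ := hf.bounded
    obtain ⟨d, hd⟩ := hg.bounded
    exact ⟨c + d, fun t => (norm_add_le _ _).trans (add_le_add (hc t) (hd t))⟩
  integral_eq s hs := by
    simp_rw [mul_add]
    rw [integral_add (hf.integrable s) (hg.integrable s), hf.integral_eq s hs, hg.integral_eq s hs]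

theorem const_mul (hf : HasHardyValue q f v) (c : ℂ) :
    HasHardyValue q (fun t => c * f t) (c * v) where
  continuous := continuous_const.mul hf.continuous
  bounded := by
    obtain ⟨d, hd⟩ := hf.bounded
    exact ⟨‖c‖ * d, fun t => by
      rw [norm_mul]; exact mul_le_mul_of_nonneg_left (hd t) (norm_nonneg _)⟩
  integral_eq s hs := by
    simp_rw [mul_left_comm _ c]
    rw [integral_const_mul, hf.integral_eq s hs]

/-- Since `1 / w = ∫₀^∞ exp (-w u) du` for `Re w > 0`, multiplication by the inverse form is a
superposition of characters whose frequency moves from `s` to `s + b u`. The sign of `b` keeps this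
frequency nonnegative, so the defining identity applies under the integral. This replaces contour
integration. -/
theorem inv_affine_mul (hf : HasHardyValue q f v) (hq : 0 < q) {a : ℂ} (ha : 0 < a.re) {b : ℝ}
    (hb : 0 ≤ b) :
    HasHardyValue q (fun t => (a + b * (t * I))⁻¹ * f t) ((a + b * q)⁻¹ * v) := by
  have hre (t : ℝ) : (a + b * (t * I)).re = a.re := by simp
  have hne (t : ℝ) : a + b * (t * I) ≠ 0 := fun h => ha.ne' (by rw [← hre t, h]; simp)
  have hcont : Continuous fun t : ℝ => (a + b * (t * I))⁻¹ :=
    Continuous.inv₀ (by fun_prop) hne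
  have hfc := hf.continuous
  obtain ⟨c, hc⟩ := hf.bounded
  refine ⟨hcont.mul hf.continuous, ⟨a.re⁻¹ * c, fun t => ?_⟩, fun s hs => ?_⟩
  · rw [norm_mul, norm_inv]
    refine mul_le_mul (inv_anti₀ ha ?_) (hc t) (norm_nonneg _) (by positivity)
    rw [← hre t]
    exact (le_abs_self _).trans (abs_re_le_norm _)
  · have hL (t : ℝ) : (a + b * (t * I))⁻¹ = ∫ u in Set.Ioi (0 : ℝ), cexp (-(a + b * (t * I)) * u) := by
      rw [integral_exp_mul_complex_Ioi (by rw [neg_re, hre]; simpa using ha)]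
      rw [ofReal_zero, mul_zero, Complex.exp_zero, neg_div_neg_eq, one_div]
    have hstep : ∀ t : ℝ, cexp (-(s * t) * I) * ((a + b * (t * I))⁻¹ * f t) =
        ∫ u in Set.Ioi (0 : ℝ), cexp (-a * u) * (cexp (-(((s + b * u : ℝ) : ℂ) * t) * I) * f t) := by
      intro t
      rw [hL, ← integral_mul_const, ← integral_const_mul]
      refine integral_congr_ae (Filter.Eventually.of_forall fun u => ?_)
      simp only [← mul_assoc, ← Complex.exp_add]
      congr 2
      push_cast
      ring
    simp_rw [hstep]
    rw [integral_integral_swap]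
    · have : ∀ u ∈ Set.Ioi (0 : ℝ), ∫ t, cexp (-a * u) * (cexp (-(((s + b * u : ℝ) : ℂ) * t) * I) * f t) ∂cauchyLaw q
          = (cexp (-(q * s)) * v) * cexp (-(a + b * q) * u) := by
        intro u hu
        have hu' : 0 ≤ s + b * u := add_nonneg hs (mul_nonneg hb (le_of_lt hu))
        rw [integral_const_mul, hf.integral_eq _ hu', mul_comm _ v, mul_comm _ v, mul_left_comm,
          mul_assoc, ← Complex.exp_add, ← Complex.exp_add]
        congr 2
        push_cast
        ring
      have hpos : 0 < (a + b * q).re := by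
        simp only [add_re, mul_re, ofReal_re, ofReal_im, mul_zero, sub_zero]
        positivity
      rw [setIntegral_congr_fun measurableSet_Ioi this, integral_const_mul,
        integral_exp_mul_complex_Ioi (by rw [neg_re]; linarith)]
      rw [ofReal_zero, mul_zero, Complex.exp_zero, neg_div_neg_eq, one_div]
      ring
    -- Fubini holds because, up to a factor of modulus one, the integrand is the product of the
    -- bounded `f` in `t` and `exp (-a u)` in `u`.
    · have h1 : Integrable (fun u : ℝ => cexp (-a * u)) (volume.restrict (Set.Ioi 0)) :=
        integrableOn_exp_mul_complex_Ioi (by simpa using ha) 0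
      have h2 : Integrable (fun p : ℝ × ℝ => f p.1 * cexp (-a * p.2))
          ((cauchyLaw q).prod (volume.restrict (Set.Ioi 0))) :=
        Integrable.mul_prod (Integrable.of_bound (C := c) (by fun_prop)
          (Filter.Eventually.of_forall hc)) h1
      refine (h2.bdd_mul (c := 1) (f := fun p : ℝ × ℝ => cexp (-(((s + b * p.2 : ℝ) : ℂ) * p.1) * I))
        (by fun_prop) ?_).congr ?_
      · exact Filter.Eventually.of_forall fun p => (norm_exp_neg_mul_I _ _).le
      · refine Filter.Eventually.of_forall fun p => ?_
        simp only [Function.uncurry]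
        ring

theorem integral_eq_value (hf : HasHardyValue q f v) : ∫ t, f t ∂cauchyLaw q = v := by
  simpa using hf.integral_eq 0 le_rfl

end HasHardyValue

end CauchyLaw

/-! ### Point values of rational functions, and reflections. -/

section Evaluation

variable {E : Type*} [DecidableEq E]

/-- The polynomials inside the field of rational functions. -/
abbrev polyToRat : MvPolynomial E ℂ →ₐ[ℂ] LineRatFunc E :=
  Algebra.algHom ℂ (MvPolynomial E ℂ) (LineRatFunc E)

theorem polyToRat_injective : Function.Injective (polyToRat (E := E)) :=
  IsFractionRing.injective (MvPolynomial E ℂ) (LineRatFunc E)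

/-- The rational function `f` is regular at `p` with value `v`. -/
def HasValueAt (p : E → ℂ) (f : LineRatFunc E) (v : ℂ) : Prop :=
  ∃ P Q : MvPolynomial E ℂ, MvPolynomial.eval p Q ≠ 0 ∧ f * polyToRat Q = polyToRat P ∧
    v * MvPolynomial.eval p Q = MvPolynomial.eval p P

namespace HasValueAt

variable {p : E → ℂ} {f g : LineRatFunc E} {v w : ℂ}

theorem unique (h : HasValueAt p f v) (h' : HasValueAt p f w) : v = w := by
  obtain ⟨P, Q, hQ, hf, hv⟩ := h
  obtain ⟨P', Q', hQ', hf', hw⟩ := h'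
  have h1 : P * Q' = P' * Q := polyToRat_injective <| by
    rw [map_mul, map_mul, ← hf, ← hf']; ring
  have h2 := congrArg (MvPolynomial.eval p) h1
  rw [map_mul, map_mul, ← hv, ← hw] at h2
  have h3 : (v - w) * (MvPolynomial.eval p Q * MvPolynomial.eval p Q') = 0 := by
    linear_combination h2
  exact sub_eq_zero.1 ((mul_eq_zero.1 h3).resolve_right (mul_ne_zero hQ hQ'))

theorem of_poly (P : MvPolynomial E ℂ) : HasValueAt p (polyToRat P) (MvPolynomial.eval p P) :=
  ⟨P, 1, by simp, by simp, by simp⟩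

theorem algebraMap (c : ℂ) : HasValueAt p (algebraMap ℂ (LineRatFunc E) c) c := by
  have h := of_poly (p := p) (MvPolynomial.C c)
  rw [MvPolynomial.eval_C] at h
  convert h
  exact (polyToRat.commutes c).symm

theorem add (h : HasValueAt p f v) (h' : HasValueAt p g w) : HasValueAt p (f + g) (v + w) := by
  obtain ⟨P, Q, hQ, hf, hv⟩ := h
  obtain ⟨P', Q', hQ', hf', hw⟩ := h'
  refine ⟨P * Q' + P' * Q, Q * Q', by simp [hQ, hQ'], ?_, ?_⟩
  · rw [map_add, map_mul, map_mul, map_mul, ← hf, ← hf']; ring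
  · rw [map_add, map_mul, map_mul, map_mul, ← hv, ← hw]; ring

theorem mul (h : HasValueAt p f v) (h' : HasValueAt p g w) : HasValueAt p (f * g) (v * w) := by
  obtain ⟨P, Q, hQ, hf, hv⟩ := h
  obtain ⟨P', Q', hQ', hf', hw⟩ := h'
  refine ⟨P * P', Q * Q', by simp [hQ, hQ'], ?_, ?_⟩
  · rw [map_mul, map_mul, ← hf, ← hf']; ring
  · rw [map_mul, map_mul, ← hv, ← hw]; ring

theorem inv (h : HasValueAt p f v) (hv0 : v ≠ 0) : HasValueAt p f⁻¹ v⁻¹ := by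
  obtain ⟨P, Q, hQ, hf, hv⟩ := h
  have hP : MvPolynomial.eval p P ≠ 0 := hv ▸ mul_ne_zero hv0 hQ
  have hf0 : f ≠ 0 := by
    rintro rfl
    rw [zero_mul, eq_comm, map_eq_zero_iff _ polyToRat_injective] at hf
    simp [hf] at hP
  exact ⟨Q, P, hP, by rw [← hf, inv_mul_cancel_left₀ hf0], by
    rw [← hv, inv_mul_cancel_left₀ hv0]⟩

end HasValueAt

open Classical in
/-- The value of a rational function at a point where it is regular. -/
def valueAt (p : E → ℂ) (f : LineRatFunc E) : ℂ :=
  if h : ∃ v, HasValueAt p f v then h.choose else 0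

theorem HasValueAt.valueAt_eq {p : E → ℂ} {f : LineRatFunc E} {v : ℂ} (h : HasValueAt p f v) :
    valueAt p f = v := by
  have h' : ∃ v, HasValueAt p f v := ⟨v, h⟩
  rw [valueAt, dif_pos h']
  exact h'.choose_spec.unique h

/-- The reflection `R̂ᵢ` as a field automorphism. -/
def reflectionEquiv (i : E) : LineRatFunc E ≃ₐ[ℂ] LineRatFunc E :=
  IsFractionRing.algEquivOfAlgEquiv (K := LineRatFunc E) (L := LineRatFunc E) (reflectPoly i)

theorem reflection_mul (i : E) (f g : LineRatFunc E) :
    reflection i (f * g) = reflection i f * reflection i g :=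
  map_mul (reflectionEquiv i) f g

theorem reflection_inv (i : E) (f : LineRatFunc E) : reflection i f⁻¹ = (reflection i f)⁻¹ :=
  map_inv₀ (reflectionEquiv i) f

theorem reflection_poly (i : E) (P : MvPolynomial E ℂ) :
    reflection i (polyToRat P) = polyToRat (reflectPolyHom i P) := by
  have h := reflection_div i P 1
  simp only [map_one, div_one] at h
  exact h

theorem reflection_reflection (i : E) (f : LineRatFunc E) : reflection i (reflection i f) = f := by
  obtain ⟨P, Q, -, rfl⟩ := IsFractionRing.div_surjective (A := MvPolynomial E ℂ) f
  have h (P) : reflectPolyHom i (reflectPolyHom i P) = P :=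
    DFunLike.congr_fun (reflectPolyHom_self i) P
  rw [reflection_div, reflection_div, h, h]

theorem eval_reflectPolyHom (i : E) (p : E → ℂ) (P : MvPolynomial E ℂ) :
    MvPolynomial.eval p (reflectPolyHom i P) =
      MvPolynomial.eval (Function.update p i (-p i)) P := by
  have : ((MvPolynomial.aeval p).comp (reflectPolyHom i) : MvPolynomial E ℂ →ₐ[ℂ] ℂ) =
      MvPolynomial.aeval (Function.update p i (-p i)) := by
    ext j
    by_cases h : j = i
    · subst h; simp [reflectPolyHom]
    · simp [reflectPolyHom, h]
  exact DFunLike.congr_fun this P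

theorem HasValueAt.reflection {i : E} {p : E → ℂ} {f : LineRatFunc E} {v : ℂ}
    (h : HasValueAt (Function.update p i (-p i)) f v) : HasValueAt p (reflection i f) v := by
  obtain ⟨P, Q, hQ, hf, hv⟩ := h
  refine ⟨reflectPolyHom i P, reflectPolyHom i Q, ?_, ?_, ?_⟩
  · rwa [eval_reflectPolyHom]
  · rw [← reflection_poly, ← reflection_poly, ← hf, reflection_mul]
  · rwa [eval_reflectPolyHom, eval_reflectPolyHom]

end Evaluation

/-! ### Algebras generated by inverses of affine forms with positive real part. -/

section LinearForms

variable {E : Type*} [Fintype E] [DecidableEq E]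

/-- The affine form `∑ cᵢ zᵢ + i n`. -/
def affineForm (c : E → ℝ) (n : ℝ) : MvPolynomial E ℂ :=
  ∑ i, MvPolynomial.C (c i : ℂ) * MvPolynomial.X i + MvPolynomial.C (n * Complex.I)

theorem eval_affineForm (c : E → ℝ) (n : ℝ) (p : E → ℂ) :
    MvPolynomial.eval p (affineForm c n) = ∑ i, (c i : ℂ) * p i + n * Complex.I := by
  simp [affineForm]

theorem reflectPolyHom_affineForm (l : E) (c : E → ℝ) (n : ℝ) :
    reflectPolyHom l (affineForm c n) = affineForm (Function.update c l (-c l)) n := by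
  refine MvPolynomial.funext fun p => ?_
  rw [eval_reflectPolyHom, eval_affineForm, eval_affineForm]
  congr 1
  refine Finset.sum_congr rfl fun i _ => ?_
  by_cases h : i = l
  · subst h; simp
  · simp [h]

/-- The conditions on the coefficients of a denominator: only the variables in `X` occur, those
outside `U` have nonnegative coefficients, and at least one of the latter is positive. -/
structure IsDenominator (X U : Finset E) (c : E → ℝ) : Prop where
  support : ∀ i, i ∉ X → c i = 0
  nonneg : ∀ i, i ∉ U → 0 ≤ c i
  pos : ∃ i, i ∉ U ∧ 0 < c i

/-- The inverses of the admissible denominators whose coefficients satisfy `p`. -/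
def invForms (X U : Finset E) (p : (E → ℝ) → Prop) : Set (LineRatFunc E) :=
  {f | ∃ c n, IsDenominator X U c ∧ p c ∧ f = (polyToRat (affineForm c n))⁻¹}

/-- The algebra generated by the inverses of the admissible denominators. -/
def denomAlgebra (X U : Finset E) : Subalgebra ℂ (LineRatFunc E) :=
  Algebra.adjoin ℂ (invForms X U fun _ => True)

/-- The evaluation point: the variables in `U` are imaginary, the others real. -/
def mixedPoint (U : Finset E) (q y : E → ℝ) (i : E) : ℂ :=
  if i ∈ U then y i * Complex.I else q i

theorem mixedPoint_empty (q y : E → ℝ) : mixedPoint ∅ q y = fun i => (q i : ℂ) := by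
  funext i; simp [mixedPoint]

theorem re_eval_affineForm (U : Finset E) (c : E → ℝ) (n : ℝ) (q y : E → ℝ) :
    (MvPolynomial.eval (mixedPoint U q y) (affineForm c n)).re = ∑ i ∈ Uᶜ, c i * q i := by
  rw [eval_affineForm, Complex.add_re, Complex.re_sum, ← Finset.sum_add_sum_compl U]
  rw [Finset.sum_eq_zero, zero_add]
  · simp only [Complex.re_ofReal_mul, Complex.I_re, mul_zero, add_zero]
    refine Finset.sum_congr rfl fun i hi => ?_
    simp [mixedPoint, Finset.mem_compl.1 hi]
  · intro i hi
    simp [mixedPoint, hi]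

theorem IsDenominator.sum_pos {X U : Finset E} {c : E → ℝ} (h : IsDenominator X U c) {q : E → ℝ}
    (hq : ∀ i, 0 < q i) : 0 < ∑ i ∈ Uᶜ, c i * q i := by
  obtain ⟨i, hi, hc⟩ := h.pos
  refine Finset.sum_pos' (fun j hj => mul_nonneg (h.nonneg j (Finset.mem_compl.1 hj)) (hq j).le)
    ⟨i, Finset.mem_compl.2 hi, mul_pos hc (hq i)⟩

theorem IsDenominator.eval_ne_zero {X U : Finset E} {c : E → ℝ} (h : IsDenominator X U c)
    {q : E → ℝ} (hq : ∀ i, 0 < q i) (n : ℝ) (y : E → ℝ) :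
    MvPolynomial.eval (mixedPoint U q y) (affineForm c n) ≠ 0 := fun h0 =>
  (h.sum_pos hq).ne' (by rw [← re_eval_affineForm U c n q y, h0, Complex.zero_re])

theorem IsDenominator.ne_zero {X U : Finset E} {c : E → ℝ} (h : IsDenominator X U c) (n : ℝ) :
    polyToRat (affineForm c n) ≠ 0 := by
  rw [Ne, map_eq_zero_iff _ polyToRat_injective]
  intro h0
  exact h.eval_ne_zero (q := fun _ => 1) (fun _ => one_pos) n 0 (by rw [h0, map_zero])

theorem IsDenominator.hasValueAt {X U : Finset E} {c : E → ℝ} (h : IsDenominator X U c)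
    {q : E → ℝ} (hq : ∀ i, 0 < q i) (n : ℝ) (y : E → ℝ) :
    HasValueAt (mixedPoint U q y) (polyToRat (affineForm c n))⁻¹
      (MvPolynomial.eval (mixedPoint U q y) (affineForm c n))⁻¹ :=
  (HasValueAt.of_poly _).inv (h.eval_ne_zero hq n y)

section

variable {X U : Finset E} {q : E → ℝ}

theorem hasValueAt_of_mem (hq : ∀ i, 0 < q i) (y : E → ℝ) {f : LineRatFunc E}
    (hf : f ∈ denomAlgebra X U) :
    HasValueAt (mixedPoint U q y) f (valueAt (mixedPoint U q y) f) := by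
  suffices ∃ v, HasValueAt (mixedPoint U q y) f v by
    obtain ⟨v, hv⟩ := this
    rwa [hv.valueAt_eq]
  induction hf using Algebra.adjoin_induction with
  | mem f hf =>
    obtain ⟨c, n, hc, -, rfl⟩ := hf
    exact ⟨_, hc.hasValueAt hq n y⟩
  | algebraMap c => exact ⟨c, .algebraMap c⟩
  | add f g _ _ hf hg => exact ⟨_, hf.choose_spec.add hg.choose_spec⟩
  | mul f g _ _ hf hg => exact ⟨_, hf.choose_spec.mul hg.choose_spec⟩

theorem valueAt_add (hq : ∀ i, 0 < q i) (y : E → ℝ) {f g : LineRatFunc E}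
    (hf : f ∈ denomAlgebra X U) (hg : g ∈ denomAlgebra X U) :
    valueAt (mixedPoint U q y) (f + g) =
      valueAt (mixedPoint U q y) f + valueAt (mixedPoint U q y) g :=
  ((hasValueAt_of_mem hq y hf).add (hasValueAt_of_mem hq y hg)).valueAt_eq

theorem valueAt_mul (hq : ∀ i, 0 < q i) (y : E → ℝ) {f g : LineRatFunc E}
    (hf : f ∈ denomAlgebra X U) (hg : g ∈ denomAlgebra X U) :
    valueAt (mixedPoint U q y) (f * g) =
      valueAt (mixedPoint U q y) f * valueAt (mixedPoint U q y) g :=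
  ((hasValueAt_of_mem hq y hf).mul (hasValueAt_of_mem hq y hg)).valueAt_eq

/-- The real part of an admissible form does not involve the imaginary variables, so its positive
value bounds the inverse uniformly in `y`. -/
theorem continuous_bounded_valueAt (hq : ∀ i, 0 < q i) {f : LineRatFunc E}
    (hf : f ∈ denomAlgebra X U) :
    Continuous (fun y => valueAt (mixedPoint U q y) f) ∧
      ∃ b, ∀ y, ‖valueAt (mixedPoint U q y) f‖ ≤ b := by
  induction hf using Algebra.adjoin_induction with
  | mem f hf =>
    obtain ⟨c, n, hc, -, rfl⟩ := hf
    simp_rw [(hc.hasValueAt hq n _).valueAt_eq]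
    refine ⟨Continuous.inv₀ ?_ (hc.eval_ne_zero hq n), (∑ i ∈ Uᶜ, c i * q i)⁻¹, fun y => ?_⟩
    · simp_rw [eval_affineForm]
      refine Continuous.add (continuous_finsetSum _ fun i _ => Continuous.mul continuous_const ?_)
        continuous_const
      unfold mixedPoint
      split_ifs <;> fun_prop
    · rw [norm_inv]
      refine inv_anti₀ (hc.sum_pos hq) ?_
      rw [← re_eval_affineForm U c n q y]
      exact (le_abs_self _).trans (Complex.abs_re_le_norm _)
  | algebraMap c =>
    simp_rw [(HasValueAt.algebraMap c).valueAt_eq]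
    exact ⟨continuous_const, ‖c‖, fun _ => le_rfl⟩
  | add f g hf hg ihf ihg =>
    simp_rw [valueAt_add (X := X) hq _ hf hg]
    obtain ⟨cf, a, ha⟩ := ihf
    obtain ⟨cg, b, hb⟩ := ihg
    exact ⟨cf.add cg, a + b, fun y => (norm_add_le _ _).trans (add_le_add (ha y) (hb y))⟩
  | mul f g hf hg ihf ihg =>
    simp_rw [valueAt_mul (X := X) hq _ hf hg]
    obtain ⟨cf, a, ha⟩ := ihf
    obtain ⟨cg, b, hb⟩ := ihg
    refine ⟨cf.mul cg, a * b, fun y => ?_⟩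
    rw [norm_mul]
    exact mul_le_mul (ha y) (hb y) (norm_nonneg _) ((norm_nonneg _).trans (ha y))

theorem denomAlgebra_mono {X X' U U' : Finset E}
    (h : ∀ c, IsDenominator X U c → IsDenominator X' U' c) :
    denomAlgebra X U ≤ denomAlgebra X' U' :=
  Algebra.adjoin_mono fun _ ⟨c, n, hc, hp, hf⟩ => ⟨c, n, h c hc, hp, hf⟩

end

end LinearForms

/-! ### Partial fractions as a splitting of a generated algebra. -/

section Splitting

variable {k R : Type*} [Field k] [CommRing R] [Algebra k R]

open Algebra in
-- The coefficient `w` is kept in the common part, so that it can be absorbed into either algebra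
-- later. The induction treats multiplication by `x` as an operation preserving the set of `x'` for
-- which `p * x'` splits; in this form the product case is composition.
theorem mul_mem_of_exchange {P Q : Set R}
    (h : ∀ p ∈ P, ∀ q ∈ Q, ∃ g ∈ adjoin k P ⊓ adjoin k Q, ∃ g' ∈ adjoin k P ⊓ adjoin k Q,
      p * q = g * p + g' * q)
    {p : R} (hp : p ∈ P) {x : R} (hx : x ∈ adjoin k Q) :
    ∃ b ∈ adjoin k Q, ∃ w ∈ adjoin k P ⊓ adjoin k Q, p * x = b + w * p := by
  suffices H : ∀ x' ∈ adjoin k Q,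
      (∃ b ∈ adjoin k Q, ∃ w ∈ adjoin k P ⊓ adjoin k Q, p * x' = b + w * p) →
      ∃ b ∈ adjoin k Q, ∃ w ∈ adjoin k P ⊓ adjoin k Q, p * (x * x') = b + w * p by
    simpa using H 1 (one_mem _) ⟨0, zero_mem _, 1, one_mem _, by simp⟩
  induction hx using Algebra.adjoin_induction with
  | mem q hq =>
    rintro x' hx' ⟨b, hb, w, hw, e⟩
    obtain ⟨g, hg, g', hg', e'⟩ := h p hp q hq
    refine ⟨g * b + g' * q * x', add_mem (mul_mem hg.2 hb)
      (mul_mem (mul_mem hg'.2 (subset_adjoin hq)) hx'), g * w, mul_mem hg hw, ?_⟩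
    linear_combination x' * e' + g * e
  | algebraMap c =>
    rintro x' hx' ⟨b, hb, w, hw, e⟩
    refine ⟨_, mul_mem (Subalgebra.algebraMap_mem _ c) hb, _,
      mul_mem (Subalgebra.algebraMap_mem _ c) hw, ?_⟩
    linear_combination (algebraMap k R c) * e
  | add x y _ _ ihx ihy =>
    intro x' hx' hx''
    obtain ⟨b, hb, w, hw, e⟩ := ihx x' hx' hx''
    obtain ⟨b', hb', w', hw', e'⟩ := ihy x' hx' hx''
    refine ⟨_, add_mem hb hb', _, add_mem hw hw', ?_⟩
    linear_combination e + e'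
  | mul x y _ hy ihx ihy =>
    intro x' hx' hx''
    rw [mul_assoc]
    exact ihx _ (mul_mem hy hx') (ihy x' hx' hx'')

open Algebra in
/-- If products of generators of two kinds can be expanded linearly over the common part, then
the algebra they generate together is the sum of the two algebras. -/
theorem exists_add_of_exchange {P Q : Set R}
    (h : ∀ p ∈ P, ∀ q ∈ Q, ∃ g ∈ adjoin k P ⊓ adjoin k Q, ∃ g' ∈ adjoin k P ⊓ adjoin k Q,
      p * q = g * p + g' * q)
    {x : R} (hx : x ∈ adjoin k (P ∪ Q)) :
    ∃ a ∈ adjoin k P, ∃ b ∈ adjoin k Q, x = a + b := by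
  have h' : ∀ q ∈ Q, ∀ p ∈ P, ∃ g ∈ adjoin k Q ⊓ adjoin k P, ∃ g' ∈ adjoin k Q ⊓ adjoin k P,
      q * p = g * q + g' * p := by
    intro q hq p hp
    obtain ⟨g, hg, g', hg', e⟩ := h p hp q hq
    exact ⟨g', hg'.symm, g, hg.symm, by linear_combination e⟩
  suffices H : ∀ y, (∃ a ∈ adjoin k P, ∃ b ∈ adjoin k Q, y = a + b) →
      ∃ a ∈ adjoin k P, ∃ b ∈ adjoin k Q, x * y = a + b by
    simpa using H 1 ⟨1, one_mem _, 0, zero_mem _, by simp⟩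
  induction hx using Algebra.adjoin_induction with
  | mem p hp =>
    rintro _ ⟨a, ha, b, hb, rfl⟩
    rcases hp with hp | hp
    · obtain ⟨b', hb', w, hw, e⟩ := mul_mem_of_exchange h hp hb
      exact ⟨p * a + w * p, add_mem (mul_mem (subset_adjoin hp) ha)
        (mul_mem hw.1 (subset_adjoin hp)), b', hb', by linear_combination e⟩
    · obtain ⟨a', ha', w, hw, e⟩ := mul_mem_of_exchange h' hp ha
      exact ⟨a', ha', p * b + w * p, add_mem (mul_mem (subset_adjoin hp) hb)
        (mul_mem hw.1 (subset_adjoin hp)), by linear_combination e⟩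
  | algebraMap c =>
    rintro _ ⟨a, ha, b, hb, rfl⟩
    exact ⟨_, mul_mem (Subalgebra.algebraMap_mem _ c) ha, _,
      mul_mem (Subalgebra.algebraMap_mem _ c) hb, mul_add _ _ _⟩
  | add x y _ _ ihx ihy =>
    intro z hz
    obtain ⟨a, ha, b, hb, e⟩ := ihx z hz
    obtain ⟨a', ha', b', hb', e'⟩ := ihy z hz
    exact ⟨_, add_mem ha ha', _, add_mem hb hb', by linear_combination e + e'⟩
  | mul x y _ _ ihx ihy =>
    intro z hz
    rw [mul_assoc]
    exact ihx _ (ihy z hz)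

end Splitting

/-! ### The average over one imaginary variable. -/

section OneVariable

variable {E : Type*} [Fintype E] [DecidableEq E] {X U : Finset E} {l : E}

theorem affineForm_combination (a b : ℝ) (c c' : E → ℝ) (n n' : ℝ) :
    MvPolynomial.C (a : ℂ) * affineForm c n + MvPolynomial.C (b : ℂ) * affineForm c' n' =
      affineForm (fun i => a * c i + b * c' i) (a * n + b * n') := by
  refine MvPolynomial.funext fun p => ?_
  simp only [map_add, map_mul, MvPolynomial.eval_C, eval_affineForm]
  push_cast
  simp only [mul_add, add_mul, Finset.mul_sum, Finset.sum_add_distrib, mul_assoc]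
  ring

theorem adjoin_invForms_le (p : (E → ℝ) → Prop) :
    Algebra.adjoin ℂ (invForms X U p) ≤ denomAlgebra X U :=
  Algebra.adjoin_mono fun _ ⟨c, n, hc, _, hf⟩ => ⟨c, n, hc, trivial, hf⟩

/-- If `A`, `A'` have coefficients `c l > 0 ≥ c' l` at `z_l`, then `D = -c' l • A + c l • A'` is
free of `z_l` and `1 / (A A') = (c l / D) / A + (-c' l / D) / A'`. Both multipliers of `A` and `A'`
in `D` have the right sign for `D` to be admissible, and `1 / D` lies in both algebras. -/
theorem exchange_invForms {f g : LineRatFunc E}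
    (hf : f ∈ invForms X U fun c => 0 ≤ c l) (hg : g ∈ invForms X U fun c => c l ≤ 0) :
    ∃ a ∈ Algebra.adjoin ℂ (invForms X U fun c => 0 ≤ c l) ⊓
        Algebra.adjoin ℂ (invForms X U fun c => c l ≤ 0),
      ∃ b ∈ Algebra.adjoin ℂ (invForms X U fun c => 0 ≤ c l) ⊓
        Algebra.adjoin ℂ (invForms X U fun c => c l ≤ 0),
      f * g = a * f + b * g := by
  obtain ⟨c, n, hc, hcl, rfl⟩ := hf
  obtain ⟨c', n', hc', hcl', rfl⟩ := hg
  rcases hcl.eq_or_lt with h0 | h0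
  · exact ⟨0, zero_mem _, _, ⟨Algebra.subset_adjoin ⟨c, n, hc, hcl, rfl⟩,
      Algebra.subset_adjoin ⟨c, n, hc, h0.ge, rfl⟩⟩, by simp⟩
  · set d : E → ℝ := fun i => -c' l * c i + c l * c' i with hd
    have hdl : d l = 0 := by simp only [hd]; ring
    have hD : IsDenominator X U d := by
      refine ⟨fun i hi => by simp [hd, hc.support i hi, hc'.support i hi], fun i hi => ?_, ?_⟩
      · exact add_nonneg (mul_nonneg (by linarith) (hc.nonneg i hi))
          (mul_nonneg hcl (hc'.nonneg i hi))
      · obtain ⟨i, hi, hpos⟩ := hc'.pos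
        exact ⟨i, hi, add_pos_of_nonneg_of_pos (mul_nonneg (by linarith) (hc.nonneg i hi))
          (mul_pos h0 hpos)⟩
    set m : ℝ := -c' l * n + c l * n' with hm
    have hmem : (polyToRat (affineForm d m))⁻¹ ∈
        Algebra.adjoin ℂ (invForms X U fun c => 0 ≤ c l) ⊓
        Algebra.adjoin ℂ (invForms X U fun c => c l ≤ 0) :=
      ⟨Algebra.subset_adjoin ⟨d, m, hD, hdl.ge, rfl⟩,
        Algebra.subset_adjoin ⟨d, m, hD, hdl.le, rfl⟩⟩
    refine ⟨_, mul_mem hmem (Subalgebra.algebraMap_mem _ ((c l : ℝ) : ℂ)), _,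
      mul_mem hmem (Subalgebra.algebraMap_mem _ ((-c' l : ℝ) : ℂ)), ?_⟩
    have e := congrArg polyToRat (affineForm_combination (-c' l) (c l) c c' n n')
    rw [map_add, map_mul, map_mul] at e
    have h1 := hc.ne_zero n
    have h2 := hc'.ne_zero n'
    have h3 := hD.ne_zero m
    have hC (x : ℂ) : algebraMap ℂ (LineRatFunc E) x = polyToRat (MvPolynomial.C x) :=
      (polyToRat.commutes x).symm
    rw [hC, hC]
    change _ = polyToRat (affineForm d m) at e
    field_simp
    rw [← e]
    ring

theorem exists_add_of_mem_denomAlgebra {f : LineRatFunc E}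
    (hf : f ∈ denomAlgebra X U) :
    ∃ a ∈ Algebra.adjoin ℂ (invForms X U fun c => 0 ≤ c l),
      ∃ b ∈ Algebra.adjoin ℂ (invForms X U fun c => c l ≤ 0), f = a + b := by
  refine exists_add_of_exchange (fun p hp q hq => exchange_invForms hp hq)
    (Algebra.adjoin_mono ?_ hf)
  rintro _ ⟨c, n, hc, -, rfl⟩
  rcases le_total 0 (c l) with h | h
  · exact Or.inl ⟨c, n, hc, h, rfl⟩
  · exact Or.inr ⟨c, n, hc, h, rfl⟩

/-- A form with nonnegative coefficient at `z_l` keeps a positive real part when `z_l` becomes a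
positive real variable. -/
theorem adjoin_nonneg_le :
    Algebra.adjoin ℂ (invForms X U fun c => 0 ≤ c l) ≤ denomAlgebra X (U.erase l) := by
  refine Algebra.adjoin_mono ?_
  rintro _ ⟨c, n, hc, hcl, rfl⟩
  refine ⟨c, n, ⟨hc.support, fun i hi => ?_, ?_⟩, trivial, rfl⟩
  · by_cases h : i = l
    · exact h ▸ hcl
    · exact hc.nonneg i fun hU => hi (Finset.mem_erase.2 ⟨h, hU⟩)
  · obtain ⟨i, hi, hp⟩ := hc.pos
    exact ⟨i, fun h => hi (Finset.mem_of_mem_erase h), hp⟩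

theorem reflection_mem_adjoin (hX : l ∈ X) (hl : l ∈ U) {f : LineRatFunc E}
    (hf : f ∈ Algebra.adjoin ℂ (invForms X U fun c => c l ≤ 0)) :
    reflection l f ∈ Algebra.adjoin ℂ (invForms X U fun c => 0 ≤ c l) := by
  have : Algebra.adjoin ℂ (invForms X U fun c => c l ≤ 0) ≤
      (Algebra.adjoin ℂ (invForms X U fun c => 0 ≤ c l)).comap
        (reflectionEquiv l : LineRatFunc E →ₐ[ℂ] LineRatFunc E) := by
    refine Algebra.adjoin_le ?_
    rintro _ ⟨c, n, hc, hcl, rfl⟩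
    refine Algebra.subset_adjoin ⟨Function.update c l (-c l), n, ⟨?_, ?_, ?_⟩, ?_, ?_⟩
    · intro i hi
      rw [Function.update_of_ne (by rintro rfl; exact hi hX), hc.support i hi]
    · intro i hi
      rw [Function.update_of_ne (by rintro rfl; exact hi hl)]
      exact hc.nonneg i hi
    · obtain ⟨i, hi, hp⟩ := hc.pos
      exact ⟨i, hi, by rwa [Function.update_of_ne (by rintro rfl; exact hi hl)]⟩
    · simpa using hcl
    · change reflection l _ = _
      rw [reflection_inv, reflection_poly, reflectPolyHom_affineForm]
  exact this hf

theorem mixedPoint_update_neg (hl : l ∈ U) (q y : E → ℝ) (t : ℝ) :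
    mixedPoint U q (Function.update y l (-t)) =
      Function.update (mixedPoint U q (Function.update y l t)) l
        (-mixedPoint U q (Function.update y l t) l) := by
  funext i
  by_cases h : i = l
  · subst h; simp [mixedPoint, hl]
  · simp [mixedPoint, h]

theorem eval_affineForm_update (hl : l ∈ U) (c : E → ℝ) (n : ℝ) (q y : E → ℝ) :
    ∃ a : ℂ, a.re = ∑ i ∈ Uᶜ, c i * q i ∧
      (∀ t : ℝ, MvPolynomial.eval (mixedPoint U q (Function.update y l t)) (affineForm c n) =
        a + c l * (t * Complex.I)) ∧
      MvPolynomial.eval (mixedPoint (U.erase l) q y) (affineForm c n) = a + c l * q l := by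
  have h1 : ∀ t : ℝ, MvPolynomial.eval (mixedPoint U q (Function.update y l t)) (affineForm c n) =
      (∑ i ∈ Finset.univ.erase l, c i * mixedPoint U q y i + n * Complex.I) +
        c l * (t * Complex.I) := by
    intro t
    rw [eval_affineForm, ← Finset.add_sum_erase _ _ (Finset.mem_univ l)]
    rw [Finset.sum_congr rfl fun i hi => show _ = (c i : ℂ) * mixedPoint U q y i by
      simp [mixedPoint, Finset.ne_of_mem_erase hi]]
    simp only [mixedPoint, hl, if_true, Function.update_self]
    ring
  refine ⟨_, ?_, h1, ?_⟩
  · have := re_eval_affineForm U c n q (Function.update y l 0)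
    rw [h1] at this
    simpa using this
  · rw [eval_affineForm, ← Finset.add_sum_erase _ _ (Finset.mem_univ l)]
    rw [Finset.sum_congr rfl fun i hi => show _ = (c i : ℂ) * mixedPoint U q y i by
      simp [mixedPoint, Finset.ne_of_mem_erase hi]]
    simp only [mixedPoint, Finset.notMem_erase, if_false]
    ring

/-- In these forms `z_l` has a nonnegative coefficient, so the functions extend boundedly and
holomorphically to `Re z_l > 0`; the average picks out the value at `z_l = q_l`. -/
theorem hasHardyValue_of_mem (hl : l ∈ U) {q : E → ℝ} (hq : ∀ i, 0 < q i) (y : E → ℝ)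
    {f : LineRatFunc E} (hf : f ∈ Algebra.adjoin ℂ (invForms X U fun c => 0 ≤ c l)) :
    HasHardyValue (q l) (fun t => valueAt (mixedPoint U q (Function.update y l t)) f)
      (valueAt (mixedPoint (U.erase l) q y) f) := by
  -- `HasHardyValue` is not visibly closed under products, so the induction is on multiplication by
  -- `f` acting on arbitrary functions `h` with a Hardy value.
  suffices H : ∀ h v, HasHardyValue (q l) h v →
      HasHardyValue (q l) (fun t => valueAt (mixedPoint U q (Function.update y l t)) f * h t)
      (valueAt (mixedPoint (U.erase l) q y) f * v) by
    simpa using H _ _ (.const (hq l) 1)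
  have hle := adjoin_invForms_le (X := X) (U := U) fun c => 0 ≤ c l
  have hle' := adjoin_nonneg_le (X := X) (U := U) (l := l)
  induction hf using Algebra.adjoin_induction with
  | mem f hf =>
    have hf' : f ∈ denomAlgebra X (U.erase l) := hle' (Algebra.subset_adjoin hf)
    obtain ⟨c, n, hc, hcl, rfl⟩ := hf
    intro h v hh
    obtain ⟨a, ha, h1, h2⟩ := eval_affineForm_update hl c n q y
    have hpos : 0 < a.re := ha ▸ hc.sum_pos hq
    have hne : MvPolynomial.eval (mixedPoint (U.erase l) q y) (affineForm c n) ≠ 0 := by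
      rw [h2]
      intro h0
      have := congrArg Complex.re h0
      simp only [Complex.add_re, Complex.re_ofReal_mul, Complex.ofReal_re, Complex.zero_re] at this
      have := mul_nonneg hcl (hq l).le
      linarith
    simp_rw [(hc.hasValueAt hq n _).valueAt_eq, ((HasValueAt.of_poly _).inv hne).valueAt_eq, h1, h2]
    exact hh.inv_affine_mul (hq l) hpos hcl
  | algebraMap c =>
    intro h v hh
    simp_rw [(HasValueAt.algebraMap c).valueAt_eq]
    exact hh.const_mul c
  | add f g hf hg ihf ihg =>
    intro h v hh
    simp_rw [valueAt_add hq _ (hle hf) (hle hg), valueAt_add hq _ (hle' hf) (hle' hg), add_mul]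
    exact (ihf h v hh).add (ihg h v hh)
  | mul f g hf hg ihf ihg =>
    intro h v hh
    simp_rw [valueAt_mul hq _ (hle hf) (hle hg), valueAt_mul hq _ (hle' hf) (hle' hg), mul_assoc]
    exact ihf _ _ (ihg h v hh)

/-- Averaging over the imaginary variable `l` with the Cauchy law of scale `q_l` turns a rational
function `f` into a rational function `g`, and `g - f` is odd in the variable `l`. -/
theorem exists_cauchy_average (hX : l ∈ X) (hl : l ∈ U) {f : LineRatFunc E}
    (hf : f ∈ denomAlgebra X U) :
    ∃ g ∈ denomAlgebra X (U.erase l), g + reflection l g = f + reflection l f ∧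
      ∀ q : E → ℝ, (∀ i, 0 < q i) → ∀ y : E → ℝ,
        ∫ t, valueAt (mixedPoint U q (Function.update y l t)) f ∂cauchyLaw (q l) =
          valueAt (mixedPoint (U.erase l) q y) g := by
  have hle := adjoin_invForms_le (X := X) (U := U)
  have hle' := adjoin_nonneg_le (X := X) (U := U) (l := l)
  obtain ⟨a, ha, b, hb, rfl⟩ := exists_add_of_mem_denomAlgebra (l := l) hf
  have hb' := reflection_mem_adjoin hX hl hb
  -- The Cauchy law is even, so `b` has the same average as its reflection, which belongs to the
  -- same half-plane as `a`.
  refine ⟨a + reflection l b, add_mem (hle' ha) (hle' hb'), ?_, fun q hq y => ?_⟩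
  · rw [map_add, map_add, reflection_reflection]
    ring
  · have h1 := hasHardyValue_of_mem hl hq y ha
    have h2 := hasHardyValue_of_mem hl hq y hb'
    have h3 (t : ℝ) : valueAt (mixedPoint U q (Function.update y l t)) b =
        valueAt (mixedPoint U q (Function.update y l (-t))) (reflection l b) := by
      have h := hasValueAt_of_mem hq (Function.update y l t) (hle _ hb)
      have e := mixedPoint_update_neg hl q y (-t)
      rw [neg_neg] at e
      rw [e] at h
      rw [h.reflection.valueAt_eq, ← e]
    simp_rw [valueAt_add hq _ (hle _ ha) (hle _ hb), h3]
    rw [integral_add (by simpa using h1.integrable 0)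
        h2.integrable_comp_neg, integral_comp_neg_cauchyLaw (hq l)
        (fun t => valueAt (mixedPoint U q (Function.update y l t)) (reflection l b)),
      h1.integral_eq_value, h2.integral_eq_value, valueAt_add hq _ (hle' ha) (hle' hb')]

end OneVariable

/-! ### Averages over several variables and the even operator. -/

section Iteration

variable {E : Type*} [Fintype E] [DecidableEq E]

/-- Redrawing one coordinate from its own law preserves the product law. One variable can thus be
averaged out while all functions stay on `E → ℝ`, without splitting the index type. -/
theorem measurePreserving_update (μ : E → Measure ℝ) [∀ i, IsProbabilityMeasure (μ i)] (l : E) :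
    MeasurePreserving (fun p : (E → ℝ) × ℝ => Function.update p.1 l p.2)
      ((Measure.pi μ).prod (μ l)) (Measure.pi μ) := by
  have hm : Measurable fun p : (E → ℝ) × ℝ => Function.update p.1 l p.2 := by
    refine measurable_pi_lambda _ fun i => ?_
    by_cases h : i = l
    · subst h; simpa using measurable_snd
    · simp only [Function.update_of_ne h]; fun_prop
  refine ⟨hm, (Measure.pi_eq fun s hs => ?_).symm⟩
  rw [Measure.map_apply hm (MeasurableSet.univ_pi hs)]
  have : (fun p : (E → ℝ) × ℝ => Function.update p.1 l p.2) ⁻¹' Set.univ.pi s =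
      (Set.univ.pi (Function.update s l Set.univ)) ×ˢ s l := by
    ext ⟨y, t⟩
    simp only [Set.mem_preimage, Set.mem_pi, Set.mem_univ, true_imp_iff, Set.mem_prod]
    constructor
    · intro h
      refine ⟨fun i => ?_, by simpa using h l⟩
      by_cases hi : i = l
      · subst hi; simp
      · simpa [hi] using h i
    · rintro ⟨h, ht⟩ i
      by_cases hi : i = l
      · subst hi; simpa using ht
      · simpa [hi] using h i
  rw [this, Measure.prod_prod, Measure.pi_pi, ← Finset.prod_erase_mul _ _ (Finset.mem_univ l),
    ← Finset.prod_erase_mul _ (fun i => μ i (s i)) (Finset.mem_univ l)]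
  simp only [Function.update_self, measure_univ, mul_one]
  congr 1
  refine Finset.prod_congr rfl fun i hi => ?_
  rw [Function.update_of_ne (Finset.ne_of_mem_erase hi)]

theorem integral_pi_update (μ : E → Measure ℝ) [∀ i, IsProbabilityMeasure (μ i)] (l : E)
    {φ : (E → ℝ) → ℂ} (hφ : Integrable φ (Measure.pi μ)) :
    ∫ y, φ y ∂Measure.pi μ = ∫ y, ∫ t, φ (Function.update y l t) ∂μ l ∂Measure.pi μ := by
  have hp := measurePreserving_update μ l
  have h1 := hp.integrable_comp_of_integrable hφ
  rw [← integral_prod (fun p : (E → ℝ) × ℝ => φ (Function.update p.1 l p.2)) h1]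
  conv_lhs => rw [← hp.map_eq]
  exact integral_map hp.aemeasurable (by rw [hp.map_eq]; exact hφ.aestronglyMeasurable)

variable {X U : Finset E} {q : E → ℝ}

/-- The mean of a rational function when the variables in `U` are replaced by `i` times
independent Cauchy variables of scales `q`. -/
def cauchyMean (U : Finset E) (q : E → ℝ) (f : LineRatFunc E) : ℂ :=
  ∫ y, valueAt (mixedPoint U q y) f ∂Measure.pi fun i => cauchyLaw (q i)

theorem cauchyMean_empty (f : LineRatFunc E) :
    cauchyMean ∅ q f = valueAt (fun i => (q i : ℂ)) f := by
  simp [cauchyMean, mixedPoint_empty]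

theorem hasValueAt_of_eqOn (hq : ∀ i, 0 < q i) (y : E → ℝ) {f : LineRatFunc E}
    (hf : f ∈ denomAlgebra X U) {p : E → ℂ} (hp : ∀ i ∈ X, p i = mixedPoint U q y i) :
    HasValueAt p f (valueAt (mixedPoint U q y) f) := by
  induction hf using Algebra.adjoin_induction with
  | mem f hf =>
    obtain ⟨c, n, hc, -, rfl⟩ := hf
    rw [(hc.hasValueAt hq n y).valueAt_eq]
    have : MvPolynomial.eval p (affineForm c n) =
        MvPolynomial.eval (mixedPoint U q y) (affineForm c n) := by
      rw [eval_affineForm, eval_affineForm]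
      congr 1
      refine Finset.sum_congr rfl fun i _ => ?_
      by_cases hi : i ∈ X
      · rw [hp i hi]
      · simp [hc.support i hi]
    rw [← this]
    exact (HasValueAt.of_poly _).inv (this ▸ hc.eval_ne_zero hq n y)
  | algebraMap c =>
    rw [(HasValueAt.algebraMap c).valueAt_eq]
    exact .algebraMap c
  | add f g hf hg ihf ihg => rw [valueAt_add hq y hf hg]; exact ihf.add ihg
  | mul f g hf hg ihf ihg => rw [valueAt_mul hq y hf hg]; exact ihf.mul ihg

theorem integrable_valueAt (hq : ∀ i, 0 < q i) {f : LineRatFunc E} (hf : f ∈ denomAlgebra X U) :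
    Integrable (fun y => valueAt (mixedPoint U q y) f) (Measure.pi fun i => cauchyLaw (q i)) := by
  obtain ⟨hc, b, hb⟩ := continuous_bounded_valueAt hq hf
  exact Integrable.of_bound hc.aestronglyMeasurable b (Filter.Eventually.of_forall hb)

theorem denomAlgebra_le_univ : denomAlgebra X U ≤ denomAlgebra Finset.univ U :=
  denomAlgebra_mono fun _ h => ⟨fun i hi => (hi (Finset.mem_univ i)).elim, h.nonneg, h.pos⟩

/-- Variables that do not occur have coefficient zero, hence may be regarded as real or as
imaginary. -/
theorem denomAlgebra_le_sdiff {K : Finset E} :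
    denomAlgebra Kᶜ U ≤ denomAlgebra Kᶜ (U \ K) :=
  denomAlgebra_mono fun c h => ⟨h.support, fun i hi => by
    by_cases hK : i ∈ K
    · exact (h.support i (by simpa using hK)).ge
    · exact h.nonneg i fun hU => hi (Finset.mem_sdiff.2 ⟨hU, hK⟩),
    by
      obtain ⟨i, hi, hp⟩ := h.pos
      exact ⟨i, fun h' => hi (Finset.mem_sdiff.1 h').1, hp⟩⟩

theorem denomAlgebra_anti_compl {K K' : Finset E} (h : K ⊆ K') :
    denomAlgebra K'ᶜ U ≤ denomAlgebra Kᶜ U :=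
  denomAlgebra_mono fun _ hc => ⟨fun i hi => hc.support i fun hi' =>
    hi (Finset.compl_subset_compl.2 h hi'), hc.nonneg, hc.pos⟩

theorem commute_one_add_reflection (i k : E) :
    Commute (1 + reflection i) (1 + reflection k) :=
  (Commute.one_left _).add_left ((Commute.one_right _).add_right (reflection_commute i k))

/-- The operator `∏_{i ∈ K} (1 + R̂ᵢ)`. -/
def evenOperator (K : Finset E) : Module.End ℂ (LineRatFunc E) :=
  K.noncommProd (fun i => 1 + reflection i) fun i _ k _ _ => commute_one_add_reflection i k

theorem evenOperator_insert {K : Finset E} {l : E} (hl : l ∉ K) :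
    evenOperator (insert l K) = (1 + reflection l) * evenOperator K :=
  Finset.noncommProd_insert_of_notMem _ _ _ _ hl

theorem evenOperator_insert' {K : Finset E} {l : E} (hl : l ∉ K) :
    evenOperator (insert l K) = evenOperator K * (1 + reflection l) :=
  Finset.noncommProd_insert_of_notMem' _ _ _ _ hl

theorem cutOperator_insert {K : Finset E} {l : E} (hl : l ∉ K) :
    cutOperator (insert l K) = (1 - reflection l) * cutOperator K :=
  Finset.noncommProd_insert_of_notMem _ _ _ _ hl

theorem cauchyMean_step {l : E} (hq : ∀ i, 0 < q i) {f g h : LineRatFunc E}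
    (hf : f ∈ denomAlgebra X U) (hg : g ∈ denomAlgebra X (U.erase l))
    (hh : h ∈ denomAlgebra {l}ᶜ U)
    (hfg : ∀ y : E → ℝ, ∫ t, valueAt (mixedPoint U q (Function.update y l t)) f ∂cauchyLaw (q l) =
      valueAt (mixedPoint (U.erase l) q y) g) :
    cauchyMean U q (h * f) = cauchyMean (U.erase l) q (h * g) := by
  have hf' := denomAlgebra_le_univ hf
  have hg' := denomAlgebra_le_univ hg
  have hh' := denomAlgebra_le_univ hh
  have hh2 : h ∈ denomAlgebra {l}ᶜ (U.erase l) := by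
    have := denomAlgebra_le_sdiff hh
    rwa [Finset.sdiff_singleton_eq_erase] at this
  rw [cauchyMean, integral_pi_update _ l (integrable_valueAt hq (mul_mem hh' hf')), cauchyMean]
  refine integral_congr_ae (Filter.Eventually.of_forall fun y => ?_)
  have e (t : ℝ) : valueAt (mixedPoint U q (Function.update y l t)) h =
      valueAt (mixedPoint (U.erase l) q y) h := by
    refine (hasValueAt_of_eqOn hq y hh2 fun i hi => ?_).valueAt_eq
    have : i ≠ l := by simpa using hi
    simp [mixedPoint, this]
  simp only
  simp_rw [valueAt_mul hq _ hh' hf', e]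
  rw [integral_const_mul, hfg, valueAt_mul hq _ (denomAlgebra_le_univ hh2) hg']

/-- The function changes at each step by a part odd in the averaged variable, which the
corresponding factor of `evenOperator K` kills. The spectator `h`, free of the variables in `K`,
allows only some of the factors of a product to be averaged. The function `g` is chosen before `h`
and `q`. -/
theorem exists_iterated_cauchy_average {K : Finset E} (hKX : K ⊆ X) (hKU : K ⊆ U)
    {f : LineRatFunc E} (hf : f ∈ denomAlgebra X U) :
    ∃ g ∈ denomAlgebra X (U \ K), evenOperator K g = evenOperator K f ∧
      ∀ h ∈ denomAlgebra Kᶜ U, ∀ q : E → ℝ, (∀ i, 0 < q i) →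
        cauchyMean U q (h * f) = cauchyMean (U \ K) q (h * g) := by
  induction K using Finset.induction_on with
  | empty => exact ⟨f, by simpa using hf, rfl, fun h _ q _ => by simp⟩
  | insert l K hl ih =>
    obtain ⟨g₀, hg₀, he, hm⟩ := ih ((Finset.subset_insert _ _).trans hKX)
      ((Finset.subset_insert _ _).trans hKU)
    have hlU : l ∈ U \ K := Finset.mem_sdiff.2 ⟨hKU (Finset.mem_insert_self _ _), hl⟩
    obtain ⟨g, hg, he', hm'⟩ := exists_cauchy_average (hKX (Finset.mem_insert_self _ _)) hlU hg₀
    have hU : (U \ K).erase l = U \ insert l K := by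
      ext i; simp only [Finset.mem_erase, Finset.mem_sdiff, Finset.mem_insert]; tauto
    refine ⟨g, hU ▸ hg, ?_, fun h hh q hq => ?_⟩
    -- The factor for `l` is applied first to pass from `g` to `g₀`, then moved to the outside so
    -- that the induction hypothesis applies to `evenOperator K g₀`.
    · have : (1 + reflection l) g = (1 + reflection l) g₀ := he'
      rw [evenOperator_insert' hl, Module.End.mul_apply, this, ← Module.End.mul_apply,
        ← evenOperator_insert' hl, evenOperator_insert hl, Module.End.mul_apply, he,
        Module.End.mul_apply]
    · have hhK : h ∈ denomAlgebra Kᶜ U := denomAlgebra_anti_compl (Finset.subset_insert _ _) hh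
      have hhl : h ∈ denomAlgebra {l}ᶜ (U \ K) := by
        refine denomAlgebra_mono (fun c hc => ⟨fun i hi => ?_, fun i hi => ?_, ?_⟩) hh
        · refine hc.support i ?_
          have : i = l := by simpa using hi
          simp [this]
        · by_cases hK : i ∈ K
          · exact (hc.support i (by simp [hK])).ge
          · exact hc.nonneg i fun hU => hi (Finset.mem_sdiff.2 ⟨hU, hK⟩)
        · obtain ⟨i, hi, hp⟩ := hc.pos
          exact ⟨i, fun h' => hi (Finset.mem_sdiff.1 h').1, hp⟩
      rw [hm h hhK q hq, cauchyMean_step hq hg₀ hg hhl (hm' q hq), hU]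

theorem reflection_eq_self_of_mem {c : E} (hcU : c ∉ X) {f : LineRatFunc E}
    (hf : f ∈ denomAlgebra X U) : reflection c f = f := by
  have : denomAlgebra X U ≤ AlgHom.equalizer
      (reflectionEquiv c : LineRatFunc E →ₐ[ℂ] LineRatFunc E) (AlgHom.id ℂ _) := by
    refine Algebra.adjoin_le ?_
    rintro _ ⟨a, n, ha, -, rfl⟩
    change reflection c _ = _
    rw [reflection_inv, reflection_poly, reflectPolyHom_affineForm]
    simp only [AlgHom.id_apply]
    congr 3
    refine (Function.update_eq_self_iff).2 ?_
    simp [ha.support c hcU]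
  exact this hf

end Iteration

/-! ### The tree factors, and the rational function evaluating their mean. -/

section TreeFactors

variable {E : Type*} [Fintype E] [DecidableEq E]

/-- The coefficients of `z_j + σ ∑_{l ∈ U} m_l z_l`. -/
def treeCoeff (U : Finset E) (σ : ℝ) (m : E → ℝ) (j : E) (i : E) : ℝ :=
  (if i = j then 1 else 0) + σ * if i ∈ U then m i else 0

/-- The rational function `1 / (z_j² + x_j²)` in the Wick-rotated variables, where
`x_j = ∑_{l ∈ U} m_l y_l + n`. -/
def treeFactor (U : Finset E) (m : E → ℝ) (n : ℝ) (j : E) : LineRatFunc E :=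
  (polyToRat (affineForm (treeCoeff U 1 m j) n))⁻¹ *
    (polyToRat (affineForm (treeCoeff U (-1) m j) (-n)))⁻¹

variable {X U : Finset E} {m : E → ℝ} {j : E}

theorem isDenominator_treeCoeff (hj : j ∉ U) (hjX : j ∈ X) (hm : ∀ i ∈ U, i ∉ X → m i = 0)
    (σ : ℝ) : IsDenominator X U (treeCoeff U σ m j) where
  support i hi := by
    have : i ≠ j := by rintro rfl; exact hi hjX
    by_cases hU : i ∈ U
    · simp [treeCoeff, this, hm i hU hi]
    · simp [treeCoeff, this, hU]
  nonneg i hi := by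
    simp only [treeCoeff, hi, if_false, mul_zero, add_zero]
    split_ifs <;> norm_num
  pos := ⟨j, hj, by simp [treeCoeff, hj]⟩

theorem treeFactor_mem (hj : j ∉ U) (hjX : j ∈ X) (hm : ∀ i ∈ U, i ∉ X → m i = 0) (n : ℝ) :
    treeFactor U m n j ∈ denomAlgebra X U :=
  mul_mem (Algebra.subset_adjoin ⟨_, _, isDenominator_treeCoeff hj hjX hm _, trivial, rfl⟩)
    (Algebra.subset_adjoin ⟨_, _, isDenominator_treeCoeff hj hjX hm _, trivial, rfl⟩)

theorem eval_treeCoeff (hj : j ∉ U) (σ n : ℝ) (q y : E → ℝ) :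
    MvPolynomial.eval (mixedPoint U q y) (affineForm (treeCoeff U σ m j) (σ * n)) =
      q j + (σ * (∑ l ∈ U, m l * y l + n) : ℝ) * Complex.I := by
  rw [eval_affineForm]
  have : ∀ i, ((treeCoeff U σ m j i : ℝ) : ℂ) * mixedPoint U q y i =
      (if i = j then (q j : ℂ) else 0) +
        if i ∈ U then ((σ * (m i * y i) : ℝ) : ℂ) * Complex.I else 0 := by
    intro i
    by_cases h : i = j
    · subst h; simp [treeCoeff, mixedPoint, hj]
    · by_cases hU : i ∈ U
      · simp [treeCoeff, mixedPoint, h, hU]; ring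
      · simp [treeCoeff, h, hU]
  simp_rw [this]
  rw [Finset.sum_add_distrib, Finset.sum_ite_eq' , if_pos (Finset.mem_univ j), Finset.sum_ite_mem,
    Finset.univ_inter, ← Finset.sum_mul, mul_add, Finset.mul_sum]
  push_cast
  ring

theorem valueAt_treeFactor (hj : j ∉ U) (n : ℝ) {q : E → ℝ} (hq : ∀ i, 0 < q i) (y : E → ℝ) :
    valueAt (mixedPoint U q y) (treeFactor U m n j) =
      ((1 / ((∑ l ∈ U, m l * y l + n) ^ 2 + q j ^ 2) : ℝ) : ℂ) := by
  have h1 := (isDenominator_treeCoeff (X := Finset.univ) (m := m) hj (Finset.mem_univ j)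
    (by simp) 1).hasValueAt hq n y
  have h2 := (isDenominator_treeCoeff (X := Finset.univ) (m := m) hj (Finset.mem_univ j)
    (by simp) (-1)).hasValueAt hq (-n) y
  rw [treeFactor, (h1.mul h2).valueAt_eq]
  have e1 := eval_treeCoeff (m := m) hj 1 n q y
  have e2 := eval_treeCoeff (m := m) hj (-1) n q y
  rw [one_mul] at e1
  rw [neg_one_mul] at e2
  rw [e1, e2, ← mul_inv, one_div]
  push_cast
  congr 1
  linear_combination (-(∑ l ∈ U, (m l : ℂ) * y l + n) ^ 2) * Complex.I_sq

theorem neg_affineForm (c : E → ℝ) (n : ℝ) :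
    -affineForm c n = affineForm (fun i => -c i) (-n) := by
  refine MvPolynomial.funext fun p => ?_
  simp [eval_affineForm, add_comm]

theorem inv_neg_lineRatFunc (f : LineRatFunc E) : (-f)⁻¹ = -f⁻¹ := by
  exact @inv_neg (LineRatFunc E) _ _ f

/-- Changing the sign of `z_j` interchanges the two conjugate forms up to a sign each, and the two
signs cancel. -/
theorem reflection_treeFactor (hj : j ∉ U) (n : ℝ) :
    reflection j (treeFactor U m n j) = treeFactor U m n j := by
  have h (σ : ℝ) (n : ℝ) : reflection j (polyToRat (affineForm (treeCoeff U σ m j) n)) =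
      -polyToRat (affineForm (treeCoeff U (-σ) m j) (-n)) := by
    rw [reflection_poly, reflectPolyHom_affineForm, ← map_neg, neg_affineForm, neg_neg]
    congr 2
    funext i
    by_cases h : i = j
    · subst h; simp [treeCoeff, hj]
    · by_cases hU : i ∈ U <;> simp [treeCoeff, h, hU]
  rw [treeFactor, reflection_mul, reflection_inv, reflection_inv, h, h, neg_neg, neg_neg,
    inv_neg_lineRatFunc, inv_neg_lineRatFunc]
  ring

/-- The product of the factors of the lines of the tree. -/
def treeProduct (T : Finset E) (m : E → E → ℝ) (n : E → ℝ) : LineRatFunc E :=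
  ∏ j ∈ T, treeFactor Tᶜ (m j) (n j) j

/-- The factor `∏_{l ∉ T} π / z_l`. -/
def loopFactor (T : Finset E) : LineRatFunc E :=
  ∏ l ∈ Tᶜ, algebraMap ℂ _ (Real.pi : ℂ) * (polyToRat (MvPolynomial.X l))⁻¹

theorem reflection_loopFactor (T : Finset E) (i : E) :
    reflection i (loopFactor T) = if i ∈ T then loopFactor T else -loopFactor T := by
  have hi (l : E) : reflection i (algebraMap ℂ _ (Real.pi : ℂ) * (polyToRat (MvPolynomial.X l))⁻¹) =
      (if l = i then -1 else 1) *
        (algebraMap ℂ _ (Real.pi : ℂ) * (polyToRat (MvPolynomial.X l))⁻¹) := by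
    have : reflection i (algebraMap ℂ (LineRatFunc E) (Real.pi : ℂ)) = algebraMap ℂ _ (Real.pi : ℂ) :=
      (reflectionEquiv i).commutes _
    rw [reflection_mul, this, reflection_inv, reflection_poly]
    by_cases h : l = i
    · simp [reflectPolyHom, h, inv_neg_lineRatFunc]
    · simp [reflectPolyHom, h]
  have hprod : reflection i (loopFactor T) = ∏ l ∈ Tᶜ, reflection i
      (algebraMap ℂ _ (Real.pi : ℂ) * (polyToRat (MvPolynomial.X l))⁻¹) :=
    map_prod (reflectionEquiv i) _ _
  rw [hprod]
  simp_rw [hi]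
  rw [Finset.prod_mul_distrib, Finset.prod_ite_eq']
  by_cases h : i ∈ T <;> simp [h, loopFactor]

/-- Each `π / z_l` with `l ∈ K` is odd in `z_l`, so passing it through `1 - R_l` produces `1 + R_l`.
-/
theorem cutOperator_loopFactor_mul {T K : Finset E} (hK : Disjoint T K) (f : LineRatFunc E) :
    cutOperator K (loopFactor T * f) = loopFactor T * evenOperator K f := by
  induction K using Finset.induction_on with
  | empty =>
    have h1 : cutOperator (∅ : Finset E) = 1 := Finset.noncommProd_empty _ _
    have h2 : evenOperator (∅ : Finset E) = 1 := Finset.noncommProd_empty _ _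
    rw [h1, h2, Module.End.one_apply, Module.End.one_apply]
  | insert l K hl ih =>
    rw [Finset.disjoint_insert_right] at hK
    rw [cutOperator_insert hl, Module.End.mul_apply, ih hK.2, evenOperator_insert hl,
      Module.End.mul_apply, LinearMap.sub_apply, LinearMap.add_apply, reflection_mul,
      reflection_loopFactor, if_neg hK.1]
    simp only [Module.End.one_apply]
    ring

theorem loopFactor_mem (T : Finset E) : loopFactor T ∈ denomAlgebra (Finset.univ : Finset E) ∅ := by
  refine prod_mem fun l _ => mul_mem (Subalgebra.algebraMap_mem _ _) (Algebra.subset_adjoin ?_)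
  refine ⟨Pi.single l 1, 0, ⟨by simp, fun i _ => ?_, l, by simp, by simp⟩, trivial, ?_⟩
  · by_cases h : i = l
    · subst h; simp
    · simp [h]
  · congr 2
    refine MvPolynomial.funext fun p => ?_
    rw [eval_affineForm]
    simp only [Pi.single_apply]
    rw [Finset.sum_eq_single l (by intro b _ hb; simp [hb]) (by simp)]
    simp

theorem valueAt_loopFactor (T : Finset E) {q : E → ℝ} (hq : ∀ i, 0 < q i) :
    valueAt (fun i => (q i : ℂ)) (loopFactor T) = ∏ l ∈ Tᶜ, ((Real.pi / q l : ℝ) : ℂ) := by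
  refine HasValueAt.valueAt_eq ?_
  unfold loopFactor
  induction Tᶜ using Finset.induction_on with
  | empty => simpa using HasValueAt.algebraMap (p := fun i => (q i : ℂ)) (1 : ℂ)
  | insert l S hl ih =>
    rw [Finset.prod_insert hl, Finset.prod_insert hl]
    refine HasValueAt.mul ?_ ih
    have h := (HasValueAt.algebraMap (p := fun i => (q i : ℂ)) (Real.pi : ℂ)).mul
      ((HasValueAt.of_poly (p := fun i => (q i : ℂ)) (MvPolynomial.X l)).inv
        (by simpa using (hq l).ne'))
    rw [MvPolynomial.eval_X] at h
    push_cast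
    rwa [div_eq_mul_inv]

/-- The Cauchy mean of the tree product is the value of a rational function. -/
theorem exists_evaluation (T : Finset E) (m : E → E → ℝ) (n : E → ℝ) :
    ∃ F ∈ denomAlgebra (Finset.univ : Finset E) ∅, ∀ q : E → ℝ, (∀ i, 0 < q i) →
      (∏ l ∈ Tᶜ, ((Real.pi / q l : ℝ) : ℂ)) * cauchyMean Tᶜ q (treeProduct T m n) =
        valueAt (fun i => (q i : ℂ)) F := by
  have hmem : treeProduct T m n ∈ denomAlgebra Finset.univ Tᶜ :=
    prod_mem fun j hj => treeFactor_mem (by simpa using hj) (Finset.mem_univ j) (by simp) _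
  obtain ⟨g, hg, -, hm⟩ := exists_iterated_cauchy_average (Finset.subset_univ _)
    (Finset.Subset.refl _) hmem
  rw [Finset.sdiff_self] at hg hm
  refine ⟨loopFactor T * g, mul_mem (loopFactor_mem T) hg, fun q hq => ?_⟩
  have e := hm 1 (one_mem _) q hq
  have e2 := valueAt_mul hq 0 (loopFactor_mem T) hg
  rw [mixedPoint_empty] at e2
  rw [one_mul, one_mul, cauchyMean_empty] at e
  rw [e, e2, valueAt_loopFactor T hq]

/-- The rational function can be chosen to be annihilated by the operator of any cutset that meets the tree in one line whose factor involves no variables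
outside of the cutset. -/
theorem exists_evaluation_cutOperator_eq_zero {T K : Finset E} {c : E} (hc : c ∈ T)
    (hK : Disjoint T K) (m : E → E → ℝ) (n : E → ℝ) (hm : ∀ l ∉ T, l ∉ K → m c l = 0) :
    ∃ F ∈ denomAlgebra (Finset.univ : Finset E) ∅, (∀ q : E → ℝ, (∀ i, 0 < q i) →
      (∏ l ∈ Tᶜ, ((Real.pi / q l : ℝ) : ℂ)) * cauchyMean Tᶜ q (treeProduct T m n) =
        valueAt (fun i => (q i : ℂ)) F) ∧ cutOperator (insert c K) F = 0 := by
  have hcK : c ∉ K := Finset.disjoint_left.1 hK hc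
  have hKT : K ⊆ Tᶜ := fun i hi => Finset.mem_compl.2 (Finset.disjoint_right.1 hK hi)
  have hcT : c ∉ Tᶜ := by simpa using hc
  set ψ := ∏ j ∈ T.erase c, treeFactor Tᶜ (m j) (n j) j with hψ
  have hψm : ψ ∈ denomAlgebra {c}ᶜ Tᶜ := by
    refine prod_mem fun j hj => treeFactor_mem ?_ ?_ ?_ _
    · simpa using Finset.mem_of_mem_erase hj
    · simpa using Finset.ne_of_mem_erase hj
    · intro i hi hi'
      have : i = c := by simpa using hi'
      exact (hcT (this ▸ hi)).elim
  -- The lines outside both the tree and the cutset are averaged first. They do not occur in the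
  -- factor of `c`, which serves as spectator, and `z_c` does not occur in the other factors, so `χ`
  -- is free of `z_c`.
  obtain ⟨χ, hχ, -, hχm⟩ := exists_iterated_cauchy_average (K := Tᶜ \ K) (fun i hi => by
    have : i ≠ c := by
      rintro rfl
      exact hcT (Finset.mem_sdiff.1 hi).1
    simpa using this) Finset.sdiff_subset hψm
  have hU : Tᶜ \ (Tᶜ \ K) = K := by
    rw [Finset.sdiff_sdiff_eq_self hKT]
  rw [hU] at hχ hχm
  set γ := treeFactor Tᶜ (m c) (n c) c with hγ
  have hγm : γ ∈ denomAlgebra (Tᶜ \ K)ᶜ Tᶜ := by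
    refine treeFactor_mem hcT (by simp [hc]) (fun i hi hi' => ?_) _
    have : i ∈ Tᶜ \ K := by simpa using hi'
    obtain ⟨h1, h2⟩ := Finset.mem_sdiff.1 this
    exact hm i (by simpa using h1) h2
  have hγm' : γ ∈ denomAlgebra Finset.univ K := by
    have := denomAlgebra_le_univ (denomAlgebra_le_sdiff hγm)
    rwa [hU] at this
  obtain ⟨Φ, hΦ, hΦe, hΦm⟩ := exists_iterated_cauchy_average (Finset.subset_univ K)
    (Finset.Subset.refl _) (mul_mem hγm' (denomAlgebra_le_univ hχ))
  rw [Finset.sdiff_self] at hΦ hΦm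
  refine ⟨loopFactor T * Φ, mul_mem (loopFactor_mem T) hΦ, fun q hq => ?_, ?_⟩
  · have e0 : treeProduct T m n = γ * ψ := (Finset.mul_prod_erase _ _ hc).symm
    have e := hΦm 1 (one_mem _) q hq
    have e2 := valueAt_mul hq 0 (loopFactor_mem T) hΦ
    rw [mixedPoint_empty] at e2
    rw [one_mul, one_mul, cauchyMean_empty] at e
    rw [e0, hχm γ hγm q hq, e, e2, valueAt_loopFactor T hq]
  -- `γ` is even in `z_c` and `χ` does not contain it; evenness survives `evenOperator K` because
  -- reflections commute, and `1 - R_c` then gives zero.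
  · have hfix : reflection c (γ * χ) = γ * χ := by
      rw [reflection_mul, reflection_treeFactor hcT, reflection_eq_self_of_mem (by simp) hχ]
    have hcomm : Commute (reflection c) (evenOperator K) :=
      Finset.noncommProd_commute _ _ _ _ fun i _ =>
        (Commute.one_right _).add_right (reflection_commute c i)
    have hfix' : reflection c (evenOperator K (γ * χ)) = evenOperator K (γ * χ) := by
      rw [← Module.End.mul_apply, hcomm.eq, Module.End.mul_apply, hfix]
    rw [cutOperator_insert hcK, Module.End.mul_apply, cutOperator_loopFactor_mul hK, hΦe,
      LinearMap.sub_apply, reflection_mul, reflection_loopFactor, if_pos hc, hfix',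
      Module.End.one_apply, sub_self]

end TreeFactors

/-! ### Spanning trees, fundamental cuts and the solution of the vertex constraints. -/

namespace OrientedMultigraph

variable {V E : Type*} [Fintype V] [DecidableEq V] [Fintype E] [DecidableEq E]
  {G : OrientedMultigraph V E}

theorem mem_of_reachable {S : Finset E} {A : Set V} (hA : ∀ e ∈ S, G.src e ∈ A ↔ G.tgt e ∈ A)
    {u v : V} (h : (G.spanned S).Reachable u v) (hu : u ∈ A) : v ∈ A := by
  obtain ⟨w⟩ := h
  induction w with
  | nil => exact hu
  | cons hadj _ ih =>
    refine ih ?_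
    rw [spanned, SimpleGraph.fromRel_adj] at hadj
    obtain ⟨-, ⟨e, he, rfl, rfl⟩ | ⟨e, he, rfl, rfl⟩⟩ := hadj
    · exact (hA e he).1 hu
    · exact (hA e he).2 hu

theorem eq_univ_of_connected {S : Finset E} (hS : (G.spanned S).Connected) {A : Finset V}
    (hA : ∀ e ∈ S, G.src e ∈ A ↔ G.tgt e ∈ A) {u : V} (hu : u ∈ A) (v : V) : v ∈ A :=
  mem_of_reachable (A := (A : Set V)) (by simpa using hA) (hS.preconnected u v) (by simpa using hu)

theorem exists_separation [Nonempty V] {S : Finset E} (hS : ¬ (G.spanned S).Connected) :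
    ∃ A : Finset V, (∃ u, u ∈ A) ∧ (∃ v, v ∉ A) ∧ ∀ e ∈ S, G.src e ∈ A ↔ G.tgt e ∈ A := by
  classical
  rw [SimpleGraph.connected_iff] at hS
  have : ¬ (G.spanned S).Preconnected := fun h => hS ⟨h, inferInstance⟩
  simp only [SimpleGraph.Preconnected, not_forall] at this
  obtain ⟨u, v, huv⟩ := this
  refine ⟨Finset.univ.filter fun w => (G.spanned S).Reachable u w, ⟨u, by simp⟩, ⟨v, by simpa⟩,
    fun e he => ?_⟩
  by_cases hne : G.src e = G.tgt e
  · rw [hne]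
  · have hadj : (G.spanned S).Adj (G.src e) (G.tgt e) := by
      rw [spanned, SimpleGraph.fromRel_adj]
      exact ⟨hne, Or.inl ⟨e, he, rfl, rfl⟩⟩
    simp only [Finset.mem_filter, Finset.mem_univ, true_and]
    exact ⟨fun h => h.trans hadj.reachable, fun h => h.trans hadj.symm.reachable⟩

theorem spanned_mono {S S' : Finset E} (h : S ⊆ S') : G.spanned S ≤ G.spanned S' := by
  intro u v huv
  rw [spanned, SimpleGraph.fromRel_adj] at huv ⊢
  exact ⟨huv.1, huv.2.imp (fun ⟨e, he, h'⟩ => ⟨e, h he, h'⟩) fun ⟨e, he, h'⟩ => ⟨e, h he, h'⟩⟩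

theorem spanned_adj_iff {S : Finset E} {u v : V} :
    (G.spanned S).Adj u v ↔ u ≠ v ∧ ∃ e ∈ S, s(G.src e, G.tgt e) = s(u, v) := by
  rw [spanned, SimpleGraph.fromRel_adj]
  refine and_congr_right fun _ => ?_
  simp only [Sym2.eq_iff]
  constructor
  · rintro (⟨e, he, h⟩ | ⟨e, he, h, h'⟩)
    · exact ⟨e, he, Or.inl h⟩
    · exact ⟨e, he, Or.inr ⟨h, h'⟩⟩
  · rintro ⟨e, he, h | ⟨h, h'⟩⟩
    · exact Or.inl ⟨e, he, h⟩
    · exact Or.inr ⟨e, he, h, h'⟩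

/-- A tree is a minimal connected graph. Were `T.erase j` still connected, the edge of `j` would
come from another line of `T`, parallel to `j`. -/
theorem IsSpanningTree.not_connected_erase (hG : ∀ e, G.src e ≠ G.tgt e) {T : Finset E}
    (hT : G.IsSpanningTree T) {j : E} (hj : j ∈ T) : ¬ (G.spanned (T.erase j)).Connected := by
  intro hc
  have hmin := (SimpleGraph.isTree_iff_minimal_connected.1 hT.isTree).le_of_le hc
    (spanned_mono (Finset.erase_subset _ _))
  have hadj : (G.spanned T).Adj (G.src j) (G.tgt j) := spanned_adj_iff.2 ⟨hG j, j, hj, rfl⟩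
  obtain ⟨-, e, he, h⟩ := spanned_adj_iff.1 (hmin hadj)
  exact Finset.ne_of_mem_erase he (hT.noParallel (Finset.mem_of_mem_erase he) hj h)

/-- An inclusion-minimal connecting set of lines works: minimality excludes superfluous edges of the
simple graph and superfluous parallel lines alike. -/
theorem exists_isSpanningTree {S : Finset E}
    (hS : (G.spanned S).Connected) : ∃ T ⊆ S, G.IsSpanningTree T := by
  classical
  obtain ⟨T, hTS, hT⟩ := exists_minimal_le_of_wellFoundedLT
    (fun S : Finset E => (G.spanned S).Connected) S hS
  refine ⟨T, hTS, ?_, ?_⟩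
  · rw [SimpleGraph.isTree_iff_minimal_connected]
    refine ⟨hT.prop, fun H hH hle => ?_⟩
    set T' := T.filter fun e => s(G.src e, G.tgt e) ∈ H.edgeSet with hT'
    have hHT : H ≤ G.spanned T' := by
      intro u v huv
      obtain ⟨hne, e, he, h⟩ := spanned_adj_iff.1 (hle huv)
      exact spanned_adj_iff.2 ⟨hne, e, Finset.mem_filter.2 ⟨he, h ▸ huv⟩, h⟩
    have hTT' : T ⊆ T' := hT.le_of_le (hH.mono hHT) (Finset.filter_subset _ _)
    intro u v huv
    obtain ⟨hne, e, he, h⟩ := spanned_adj_iff.1 huv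
    have := (Finset.mem_filter.1 (hTT' he)).2
    rwa [h] at this
  · intro e he e' he' h
    by_contra hne
    have hle : G.spanned T ≤ G.spanned (T.erase e) := by
      intro u v huv
      obtain ⟨huv, f, hf, hs⟩ := spanned_adj_iff.1 huv
      by_cases hfe : f = e
      · subst hfe
        exact spanned_adj_iff.2 ⟨huv, e', Finset.mem_erase.2 ⟨Ne.symm hne, he'⟩,
          (h.symm.trans hs : _)⟩
      · exact spanned_adj_iff.2 ⟨huv, f, Finset.mem_erase.2 ⟨hfe, hf⟩, hs⟩
    exact Finset.notMem_erase e T (hT.le_of_le (hT.prop.mono hle) (Finset.erase_subset _ _) he)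

/-- `A` contains the target of the line `j` but not its source, and no other line of `T` joins
`A` to its complement. -/
structure IsFundamentalCut (G : OrientedMultigraph V E) (T : Finset E) (j : E) (A : Finset V) :
    Prop where
  tgt_mem : G.tgt j ∈ A
  src_notMem : G.src j ∉ A
  iff : ∀ e ∈ T, e ≠ j → (G.src e ∈ A ↔ G.tgt e ∈ A)

/-- A union of components of `S` is crossed by no line of `T` except possibly `j`, and `j` must
cross it since `T` connects everything; pass to the complement if `j` points the wrong way. Besides
`S = T.erase j`, the lemma serves for the complement of a cutset. -/
theorem exists_isFundamentalCut_of_not_connected {S T : Finset E} (hT : (G.spanned T).Connected)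
    {j : E} (hTS : T.erase j ⊆ S) (hS : ¬ (G.spanned S).Connected) :
    ∃ A : Finset V, G.IsFundamentalCut T j A ∧ ∀ e ∈ S, G.src e ∈ A ↔ G.tgt e ∈ A := by
  have := hT.nonempty
  obtain ⟨A, ⟨u, hu⟩, ⟨v, hv⟩, hA⟩ := exists_separation hS
  have hAT : ∀ e ∈ T, e ≠ j → (G.src e ∈ A ↔ G.tgt e ∈ A) := fun e he hne =>
    hA e (hTS (Finset.mem_erase.2 ⟨hne, he⟩))
  have hj : ¬ (G.src j ∈ A ↔ G.tgt j ∈ A) := by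
    intro h
    refine hv (eq_univ_of_connected hT (fun e he => ?_) hu v)
    by_cases hne : e = j
    · exact hne ▸ h
    · exact hAT e he hne
  by_cases ht : G.tgt j ∈ A
  · exact ⟨A, ⟨ht, fun hs => hj ⟨fun _ => ht, fun _ => hs⟩, hAT⟩, hA⟩
  · have hs : G.src j ∈ A := by tauto
    refine ⟨Aᶜ, ⟨by simpa, by simpa, fun e he hne => ?_⟩, fun e he => ?_⟩
    · simpa using not_congr (hAT e he hne)
    · simpa using not_congr (hA e he)

theorem IsSpanningTree.exists_cuts (hG : ∀ e, G.src e ≠ G.tgt e) {T : Finset E}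
    (hT : G.IsSpanningTree T) : ∃ A : E → Finset V, ∀ j ∈ T, G.IsFundamentalCut T j (A j) := by
  have : ∀ j, ∃ A : Finset V, j ∈ T → G.IsFundamentalCut T j A := by
    intro j
    by_cases hj : j ∈ T
    · obtain ⟨A, hA, -⟩ := exists_isFundamentalCut_of_not_connected hT.isTree.connected
        (Finset.Subset.refl _) (hT.not_connected_erase hG hj)
      exact ⟨A, fun _ => hA⟩
    · exact ⟨∅, fun h => (hj h).elim⟩
  choose A hA using this
  exact ⟨A, hA⟩

/-- The signed incidence of the line `e` with the set of vertices `A`. -/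
def cutCoeff (G : OrientedMultigraph V E) (A : Finset V) (e : E) : ℤ :=
  (if G.tgt e ∈ A then 1 else 0) - if G.src e ∈ A then 1 else 0

theorem sum_sign (hG : ∀ e, G.src e ≠ G.tgt e) (A : Finset V) (e : E) :
    ∑ v ∈ A, G.sign v e = G.cutCoeff A e := by
  have h : ∀ v, G.sign v e = (if G.tgt e = v then 1 else 0) - if G.src e = v then 1 else 0 := by
    intro v
    unfold sign
    by_cases h1 : G.tgt e = v
    · have : G.src e ≠ v := h1 ▸ hG e
      simp [h1, this]
    · by_cases h2 : G.src e = v <;> simp [h1, h2]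
  simp_rw [h]
  rw [Finset.sum_sub_distrib, Finset.sum_ite_eq, Finset.sum_ite_eq, cutCoeff]
  push_cast
  rfl

theorem Conserves.sum_cutCoeff (hG : ∀ e, G.src e ≠ G.tgt e) {N : V → ℤ} {x : E → ℝ}
    (hx : G.Conserves N x) (A : Finset V) :
    ∑ e, (G.cutCoeff A e : ℝ) * x e = ((∑ v ∈ A, N v : ℤ) : ℝ) := by
  push_cast
  rw [← Finset.sum_congr rfl fun v _ => hx v, Finset.sum_comm]
  refine Finset.sum_congr rfl fun e _ => ?_
  rw [← sum_sign hG, Finset.sum_mul]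

/-- The coefficient of the independent variable `l` in the line variable `e`. -/
def solCoeff (G : OrientedMultigraph V E) (T : Finset E) (A : E → Finset V) (e l : E) : ℤ :=
  if e ∈ T then -G.cutCoeff (A e) l else if e = l then 1 else 0

/-- The constant term of the line variable `e`. -/
def solConst (N : V → ℤ) (T : Finset E) (A : E → Finset V) (e : E) : ℤ :=
  if e ∈ T then ∑ v ∈ A e, N v else 0

/-- Add the constraints over the vertices of the fundamental cut: `e` is the only tree line crossing
it, with coefficient one, so the sum can be solved for `x e`. -/
theorem Conserves.eq_affine (hG : ∀ e, G.src e ≠ G.tgt e) {N : V → ℤ} {x : E → ℝ}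
    (hx : G.Conserves N x) {T : Finset E} {A : E → Finset V}
    (hA : ∀ j ∈ T, G.IsFundamentalCut T j (A j)) (e : E) :
    x e = ∑ l ∈ Tᶜ, (G.solCoeff T A e l : ℝ) * x l + solConst N T A e := by
  by_cases he : e ∈ T
  · have h := hx.sum_cutCoeff hG (A e)
    have hc := hA e he
    rw [← Finset.sum_add_sum_compl T, Finset.sum_eq_single e] at h
    · have h1 : G.cutCoeff (A e) e = 1 := by simp [cutCoeff, hc.tgt_mem, hc.src_notMem]
      rw [h1] at h
      simp only [solCoeff, solConst, he, if_true]
      push_cast at h ⊢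
      simp only [neg_mul, Finset.sum_neg_distrib]
      linarith
    · intro j hj hne
      have : G.cutCoeff (A e) j = 0 := by
        have := hc.iff j hj hne
        by_cases h' : G.tgt j ∈ A e <;> simp [cutCoeff, this, h']
      rw [this, Int.cast_zero, zero_mul]
    · exact fun h' => (h' he).elim
  · simp [solCoeff, solConst, he]

/-- By duality: a functional vanishing on the incidence vectors of the lines of `T` takes equal
values at the endpoints of each of them. By connectedness it is a multiple of the sum of
coordinates, so it vanishes at `b`. -/
theorem exists_conserves (hG : ∀ e, G.src e ≠ G.tgt e) {T : Finset E}
    (hT : (G.spanned T).Connected) {b : V → ℝ} (hb : ∑ v, b v = 0) :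
    ∃ x : E → ℝ, (∀ e ∉ T, x e = 0) ∧ ∀ v, ∑ e, G.sign v e * x e = b v := by
  set W : Submodule ℝ (V → ℝ) := Submodule.span ℝ
    ((fun e v => G.sign v e) '' (T : Set E)) with hW
  suffices b ∈ W by
    rw [hW, Submodule.mem_span_image_finset_iff_exists_fun'] at this
    obtain ⟨c, hc⟩ := this
    refine ⟨fun e => if e ∈ T then c e else 0, fun e he => by simp [he], fun v => ?_⟩
    rw [← hc]
    simp [mul_comm]
  by_contra hbW
  obtain ⟨φ, hφb, hφ⟩ := Submodule.exists_le_ker_of_notMem hbW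
  have hsum (f : V → ℝ) : φ f = ∑ v, f v * φ (Pi.single v 1) := by
    conv_lhs => rw [pi_eq_sum_univ' f]
    simp
  have hedge : ∀ e ∈ T, φ (Pi.single (G.src e) 1) = φ (Pi.single (G.tgt e) 1) := by
    intro e he
    have h0 : φ (fun v => G.sign v e) = 0 :=
      hφ (Submodule.subset_span ⟨e, he, rfl⟩)
    have : (fun v => G.sign v e) = Pi.single (G.tgt e) 1 - Pi.single (G.src e) 1 := by
      funext v
      by_cases h1 : G.tgt e = v
      · subst h1
        simp [sign, (hG e).symm]
      · by_cases h2 : G.src e = v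
        · subst h2
          simp [sign, h1, hG e]
        · simp [sign, h1, h2, Ne.symm h1, Ne.symm h2]
    rw [this, map_sub, sub_eq_zero] at h0
    exact h0.symm
  obtain ⟨u⟩ := hT.nonempty
  have hconst : ∀ v, φ (Pi.single v 1) = φ (Pi.single u 1) := fun v =>
    mem_of_reachable (A := {v | φ (Pi.single v 1) = φ (Pi.single u 1)})
      (fun e he => by simp only [Set.mem_ofPred_eq, hedge e he]) (hT.preconnected u v) rfl
  rw [hsum] at hφb
  simp_rw [hconst, ← Finset.sum_mul, hb, zero_mul] at hφb
  exact hφb rfl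

theorem existsUnique_conserves (hG : ∀ e, G.src e ≠ G.tgt e) {N : V → ℤ} (hN : ∑ v, N v = 0)
    {T : Finset E} (hT : G.IsSpanningTree T) (y : {e // e ∉ T} → ℝ) :
    ∃! x : E → ℝ, G.Conserves N x ∧ ∀ l : {e // e ∉ T}, x l = y l := by
  set y' : E → ℝ := fun e => if h : e ∉ T then y ⟨e, h⟩ else 0 with hy'
  have hb : ∑ v, ((N v : ℝ) - ∑ e, G.sign v e * y' e) = 0 := by
    rw [Finset.sum_sub_distrib, Finset.sum_comm]
    simp_rw [← Finset.sum_mul, sum_sign hG]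
    simp [cutCoeff, ← Int.cast_sum, hN]
  obtain ⟨x, hx, hx'⟩ := exists_conserves hG hT.isTree.connected hb
  have hex : G.Conserves N (fun e => x e + y' e) ∧ ∀ l : {e // e ∉ T}, x l + y' l = y l := by
    refine ⟨fun v => ?_, fun l => ?_⟩
    · simp_rw [mul_add, Finset.sum_add_distrib, hx' v]
      ring
    · rw [hx l l.2, zero_add, hy']
      simp [l.2]
  refine ⟨_, hex, fun z hz => ?_⟩
  obtain ⟨A, hA⟩ := hT.exists_cuts hG
  funext e
  rw [hz.1.eq_affine hG hA e, hex.1.eq_affine hG hA e]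
  congr 1
  refine Finset.sum_congr rfl fun l hl => ?_
  have hl' : l ∉ T := by simpa using hl
  rw [hz.2 ⟨l, hl'⟩, hex.2 ⟨l, hl'⟩]

variable {N : V → ℤ} {T : Finset E}

theorem solve_spec (hG : ∀ e, G.src e ≠ G.tgt e) (hN : ∑ v, N v = 0) (hT : G.IsSpanningTree T)
    (y : {e // e ∉ T} → ℝ) :
    G.Conserves N (G.solve N T y) ∧ ∀ l : {e // e ∉ T}, G.solve N T y l = y l := by
  have h := (existsUnique_conserves hG hN hT y).exists
  rw [solve, dif_pos h]
  exact h.choose_spec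

theorem eq_solve (hG : ∀ e, G.src e ≠ G.tgt e) (hN : ∑ v, N v = 0) (hT : G.IsSpanningTree T)
    {x : E → ℝ} (hx : G.Conserves N x) : x = G.solve N T fun l => x l :=
  (existsUnique_conserves hG hN hT fun l => x l).unique ⟨hx, fun _ => rfl⟩ (solve_spec hG hN hT _)

theorem solve_eq (hG : ∀ e, G.src e ≠ G.tgt e) (hN : ∑ v, N v = 0) (hT : G.IsSpanningTree T)
    {A : E → Finset V} (hA : ∀ j ∈ T, G.IsFundamentalCut T j (A j))
    (y : {e // e ∉ T} → ℝ) (e : E) :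
    G.solve N T y e = ∑ l : {e // e ∉ T}, (G.solCoeff T A e l : ℝ) * y l + solConst N T A e := by
  obtain ⟨h1, h2⟩ := solve_spec hG hN hT y
  rw [h1.eq_affine hG hA e, Finset.sum_subtype (F := inferInstance) Tᶜ (p := fun e => e ∉ T) (by simp)]
  simp_rw [h2]

end OrientedMultigraph

/-! ### Product Cauchy laws in terms of Lebesgue measure. -/

section Density

variable {ι : Type*} [Fintype ι]

theorem pi_cauchyLaw_eq {q : ι → ℝ} (hq : ∀ i, 0 < q i) :
    Measure.pi (fun i => cauchyLaw (q i)) =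
      (volume : Measure (ι → ℝ)).withDensity fun y =>
        ENNReal.ofReal (∏ i, (q i / Real.pi * (1 / (y i ^ 2 + q i ^ 2)))) := by
  set d : ι → ℝ → ℝ := fun i t => q i / Real.pi * (1 / (t ^ 2 + q i ^ 2)) with hd
  have hd0 (i t) : 0 ≤ d i t := by
    have := hq i
    have := Real.pi_pos
    positivity
  have hdi (i) : Integrable (d i) := (integrable_lorentzian (hq i)).const_mul _
  refine Measure.pi_eq fun s hs => ?_
  have hbox : ∀ y : ι → ℝ, (Set.univ.pi s).indicator
      (fun y => ENNReal.ofReal (∏ i, d i (y i))) y =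
      ENNReal.ofReal (∏ i, (s i).indicator (d i) (y i)) := by
    intro y
    by_cases h : y ∈ Set.univ.pi s
    · rw [Set.indicator_of_mem h]
      congr 1
      refine Finset.prod_congr rfl fun i _ => ?_
      rw [Set.indicator_of_mem (h i (Set.mem_univ i))]
    · rw [Set.indicator_of_notMem h]
      simp only [Set.mem_pi, Set.mem_univ, true_imp_iff, not_forall] at h
      obtain ⟨i, hi⟩ := h
      rw [Finset.prod_eq_zero (Finset.mem_univ i) (Set.indicator_of_notMem hi _),
        ENNReal.ofReal_zero]
  have hint (i) : Integrable ((s i).indicator (d i)) := (hdi i).indicator (hs i)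
  have hprod : Integrable fun y : ι → ℝ => ∏ i, (s i).indicator (d i) (y i) :=
    Integrable.fintype_prod hint
  have h0 (i t) : 0 ≤ (s i).indicator (d i) t := Set.indicator_nonneg (fun t _ => hd0 i t) t
  rw [withDensity_apply _ (MeasurableSet.univ_pi hs),
    ← lintegral_indicator (MeasurableSet.univ_pi hs)]
  refine (lintegral_congr hbox).trans ?_
  rw [← ofReal_integral_eq_lintegral_ofReal hprod
      (Filter.Eventually.of_forall fun y => Finset.prod_nonneg fun i _ => h0 i _),
    integral_fintype_prod_volume_eq_prod,
    ENNReal.ofReal_prod_of_nonneg fun i _ => integral_nonneg (h0 i)]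
  refine Finset.prod_congr rfl fun i _ => ?_
  rw [cauchyLaw_eq (hq i), withDensity_apply _ (hs i), integral_indicator (hs i),
    ofReal_integral_eq_lintegral_ofReal (hdi i).integrableOn
      (Filter.Eventually.of_forall (hd0 i))]

theorem integral_pi_cauchyLaw {q : ι → ℝ} (hq : ∀ i, 0 < q i) (f : (ι → ℝ) → ℂ) :
    (∏ i, ((Real.pi / q i : ℝ) : ℂ)) * ∫ y, f y ∂Measure.pi (fun i => cauchyLaw (q i)) =
      ∫ y : ι → ℝ, f y * ∏ i, ((1 / (y i ^ 2 + q i ^ 2) : ℝ) : ℂ) := by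
  have hpi := Real.pi_pos
  rw [pi_cauchyLaw_eq hq, integral_withDensity_eq_integral_toReal_smul (by fun_prop)
    (Filter.Eventually.of_forall fun _ => ENNReal.ofReal_lt_top), ← integral_const_mul]
  refine integral_congr_ae (Filter.Eventually.of_forall fun y => ?_)
  simp only
  rw [ENNReal.toReal_ofReal (Finset.prod_nonneg fun i _ => by
    have := hq i
    positivity), Complex.real_smul, Complex.ofReal_prod, ← mul_assoc, ← Finset.prod_mul_distrib,
    mul_comm (f y)]
  congr 1
  refine Finset.prod_congr rfl fun i _ => ?_
  rw [← Complex.ofReal_mul]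
  congr 1
  have := (hq i).ne'
  field_simp

theorem integral_pi_restrict (μ : ι → Measure ℝ) [∀ i, IsProbabilityMeasure (μ i)]
    (p : ι → Prop) [DecidablePred p] {f : ({i // p i} → ℝ) → ℂ} (hf : Continuous f) :
    ∫ y : ι → ℝ, f (fun i => y i) ∂Measure.pi μ =
      ∫ y, f y ∂Measure.pi fun i : {i // p i} => μ i := by
  have h1 := measurePreserving_piEquivPiSubtypeProd μ p
  have h2 : MeasurePreserving (fun (y : ι → ℝ) (i : {i // p i}) => y i) (Measure.pi μ)
      (Measure.pi fun i : {i // p i} => μ i) :=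
    measurePreserving_fst.comp h1
  rw [← h2.map_eq, integral_map h2.aemeasurable hf.aestronglyMeasurable]

end Density

/-! ### Invariance of integrals under unimodular affine maps. -/

section UnimodularChange

variable {ι κ : Type*} [Fintype ι] [Fintype κ] [DecidableEq ι] [DecidableEq κ]

theorem integral_comp_of_unimodular (M : Matrix κ ι ℤ) (M' : Matrix ι κ ℤ) (h : M * M' = 1)
    (h' : M' * M = 1) (b : κ → ℝ) (f : (κ → ℝ) → ℝ) :
    ∫ y : ι → ℝ, f (fun k => ∑ i, (M k i : ℝ) * y i + b k) = ∫ y, f y := by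
  -- The traces of `M * M'` and `M' * M` agree, so the two index types have the same size and a
  -- determinant makes sense after relabelling.
  have hcard : Fintype.card ι = Fintype.card κ := by
    have e1 := congrArg Matrix.trace h
    have e2 := congrArg Matrix.trace h'
    rw [Matrix.trace_mul_comm, e2, Matrix.trace_one, Matrix.trace_one] at e1
    exact_mod_cast e1
  let ε : ι ≃ κ := Fintype.equivOfCardEq hcard
  set Z : Matrix ι ι ℤ := M.submatrix ε id with hZ
  have hdet : |((Z.map (Int.cast : ℤ → ℝ)).det)| = 1 := by
    have hmul : Z * M'.submatrix id ε = 1 := by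
      rw [hZ, ← Matrix.submatrix_mul _ _ _ _ _ Function.bijective_id, h]
      exact Matrix.submatrix_one_equiv ε
    have hu : IsUnit Z.det := IsUnit.of_mul_eq_one _ (by rw [← Matrix.det_mul, hmul, Matrix.det_one])
    have : (Z.map (Int.cast : ℤ → ℝ)).det = (Z.det : ℝ) := ((Int.castRingHom ℝ).map_det Z).symm
    rw [this]
    rcases Int.isUnit_iff.1 hu with h | h <;> simp [h]
  have hdet0 : (Z.map (Int.cast : ℤ → ℝ)).det ≠ 0 := fun h => by simp [h] at hdet
  have hmap := Real.map_matrix_volume_pi_eq_smul_volume_pi hdet0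
  rw [abs_inv, hdet, inv_one, ENNReal.ofReal_one, one_smul] at hmap
  set L := Matrix.toLin' (Z.map (Int.cast : ℤ → ℝ))
  have hL : MeasurePreserving L volume volume := ⟨by
    exact (LinearMap.continuous_of_finiteDimensional L).measurable, hmap⟩
  have hemb : MeasurableEmbedding L :=
    ((LinearEquiv.ofIsUnitDet (v := Pi.basisFun ℝ ι) (v' := Pi.basisFun ℝ ι) (f := L) (by
      rw [LinearMap.toMatrix_eq_toMatrix', LinearMap.toMatrix'_toLin']
      exact isUnit_iff_ne_zero.2 hdet0)).toContinuousLinearEquiv.toHomeomorph).measurableEmbedding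
  have hε := (volume_measurePreserving_piCongrLeft (fun _ : κ => ℝ) ε)
  rw [← integral_add_right_eq_self f b, ← hε.integral_comp' (g := fun y => f (y + b))]
  refine Eq.trans ?_ (hL.integral_comp hemb _)
  refine integral_congr_ae (Filter.Eventually.of_forall fun y => ?_)
  simp only
  congr 1
  funext k
  obtain ⟨i, rfl⟩ := ε.surjective k
  rw [Pi.add_apply, MeasurableEquiv.coe_piCongrLeft, Equiv.piCongrLeft_apply_apply]
  simp [L, hZ, Matrix.mulVec, dotProduct]

end UnimodularChange

/-! ### Independence of the tree, absolute convergence, and the integral as a Cauchy mean. -/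

namespace OrientedMultigraph

variable {V E : Type*} [Fintype V] [DecidableEq V] [Fintype E] [DecidableEq E]
  {G : OrientedMultigraph V E} {N : V → ℤ} {T T' : Finset E}

/-- Both trees parametrize the same solution space. The coordinate changes are affine with integer
matrices, mutually inverse, so they preserve Lebesgue measure. -/
theorem matsubaraIntegral_eq (hG : ∀ e, G.src e ≠ G.tgt e) (hN : ∑ v, N v = 0)
    (hT : G.IsSpanningTree T) (hT' : G.IsSpanningTree T') (q : E → ℝ) :
    G.matsubaraIntegral N T q = G.matsubaraIntegral N T' q := by
  obtain ⟨A, hA⟩ := hT.exists_cuts hG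
  obtain ⟨A', hA'⟩ := hT'.exists_cuts hG
  have hback {S S' : Finset E} (hS : G.IsSpanningTree S) (hS' : G.IsSpanningTree S')
      (y : {e // e ∉ S} → ℝ) :
      G.solve N S' (fun l => G.solve N S y l) = G.solve N S y :=
    (eq_solve hG hN hS' (solve_spec hG hN hS y).1).symm
  let M (S S' : Finset E) (A : E → Finset V) : Matrix {e // e ∉ S'} {e // e ∉ S} ℤ :=
    fun k l => G.solCoeff S A k l
  have hmul {S S' : Finset E} {A A' : E → Finset V} (hS : G.IsSpanningTree S)
      (hS' : G.IsSpanningTree S') (hA : ∀ j ∈ S, G.IsFundamentalCut S j (A j))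
      (hA' : ∀ j ∈ S', G.IsFundamentalCut S' j (A' j)) : M S' S A' * M S S' A = 1 := by
    have hid (y : {e // e ∉ S} → ℝ) (k : {e // e ∉ S}) :
        ∑ l : {e // e ∉ S'}, (G.solCoeff S' A' k l : ℝ) *
          (∑ i : {e // e ∉ S}, (G.solCoeff S A l i : ℝ) * y i + solConst N S A l) +
          solConst N S' A' k = y k := by
      rw [← (solve_spec hG hN hS y).2 k, ← hback hS hS' y, solve_eq hG hN hS' hA']
      simp_rw [solve_eq hG hN hS hA]
    ext k i
    -- Comparing the affine identity at a basis vector and at zero removes the constant terms and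
    -- leaves an entry of the matrix product.
    have h1 := hid (Pi.single i 1) k
    have h0 := hid 0 k
    simp only [Pi.zero_apply, mul_zero, Finset.sum_const_zero, zero_add] at h0
    simp only [mul_add, Finset.sum_add_distrib, Pi.single_apply, mul_ite, mul_one, mul_zero,
      Finset.sum_ite_eq', Finset.mem_univ, if_true] at h1
    rw [add_assoc, h0, add_zero] at h1
    rw [Matrix.mul_apply, Matrix.one_apply]
    exact_mod_cast h1
  rw [matsubaraIntegral, matsubaraIntegral,
    ← integral_comp_of_unimodular (M T T' A) (M T' T A') (hmul hT' hT hA' hA) (hmul hT hT' hA hA')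
      (fun k => solConst N T A k)]
  refine integral_congr_ae (Filter.Eventually.of_forall fun y => ?_)
  have : (fun k : {e // e ∉ T'} => ∑ i : {e // e ∉ T}, (M T T' A k i : ℝ) * y i + solConst N T A k) =
      fun k : {e // e ∉ T'} => G.solve N T y k := by
    funext k
    rw [solve_eq hG hN hT hA]
  simp only
  rw [this, integrand, integrand, hback hT hT']

theorem integrand_eq (hG : ∀ e, G.src e ≠ G.tgt e) (hN : ∑ v, N v = 0) (hT : G.IsSpanningTree T)
    (q : E → ℝ) (y : {e // e ∉ T} → ℝ) :
    G.integrand N T q y = (∏ j ∈ T, 1 / (G.solve N T y j ^ 2 + q j ^ 2)) *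
      ∏ l : {e // e ∉ T}, 1 / (y l ^ 2 + q l ^ 2) := by
  rw [integrand, ← Finset.prod_mul_prod_compl T]
  congr 1
  rw [Finset.prod_subtype (F := inferInstance) Tᶜ (p := fun e => e ∉ T) (by simp)]
  simp_rw [(solve_spec hG hN hT y).2]

theorem continuous_solve (hG : ∀ e, G.src e ≠ G.tgt e) (hN : ∑ v, N v = 0)
    (hT : G.IsSpanningTree T) (e : E) : Continuous fun y => G.solve N T y e := by
  obtain ⟨A, hA⟩ := hT.exists_cuts hG
  simp_rw [solve_eq hG hN hT hA]
  fun_prop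

theorem continuous_treePart (hG : ∀ e, G.src e ≠ G.tgt e) (hN : ∑ v, N v = 0)
    (hT : G.IsSpanningTree T) {q : E → ℝ} (hq : ∀ i, 0 < q i) :
    Continuous fun y => ∏ j ∈ T, 1 / (G.solve N T y j ^ 2 + q j ^ 2) := by
  refine continuous_finsetProd _ fun j _ => ?_
  have := continuous_solve hG hN hT j
  refine Continuous.div continuous_const (by fun_prop) fun y => ?_
  have := hq j
  positivity

/-- The tree factors are bounded by `1 / q_j²`, and the others form an integrable product of
Lorentzians in independent variables. -/
theorem integrable_integrand (hG : ∀ e, G.src e ≠ G.tgt e) (hN : ∑ v, N v = 0)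
    (hT : G.IsSpanningTree T) {q : E → ℝ} (hq : ∀ i, 0 < q i) :
    Integrable (G.integrand N T q) := by
  have h : G.integrand N T q = fun y => (∏ j ∈ T, 1 / (G.solve N T y j ^ 2 + q j ^ 2)) *
      ∏ l : {e // e ∉ T}, 1 / (y l ^ 2 + q l ^ 2) := funext (integrand_eq hG hN hT q)
  rw [h]
  refine Integrable.bdd_mul (c := ∏ j ∈ T, 1 / q j ^ 2)
    (Integrable.fintype_prod fun l : {e // e ∉ T} => integrable_lorentzian (hq l))
    (continuous_treePart hG hN hT hq).aestronglyMeasurable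
    (Filter.Eventually.of_forall fun y => ?_)
  rw [Real.norm_of_nonneg (Finset.prod_nonneg fun j _ => by positivity)]
  refine Finset.prod_le_prod (fun j _ => by positivity) fun j _ => ?_
  have := hq j
  exact one_div_le_one_div_of_le (by positivity) (by nlinarith [sq_nonneg (G.solve N T y j)])

/-- The Matsubara integral as a Cauchy mean. -/
theorem matsubaraIntegral_eq_cauchyMean (hG : ∀ e, G.src e ≠ G.tgt e) (hN : ∑ v, N v = 0)
    (hT : G.IsSpanningTree T) {A : E → Finset V} (hA : ∀ j ∈ T, G.IsFundamentalCut T j (A j))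
    {q : E → ℝ} (hq : ∀ i, 0 < q i) :
    ((G.matsubaraIntegral N T q : ℝ) : ℂ) = (∏ l ∈ Tᶜ, ((Real.pi / q l : ℝ) : ℂ)) *
      cauchyMean Tᶜ q (treeProduct T (fun j l => G.solCoeff T A j l)
        fun j => solConst N T A j) := by
  have hval (y : E → ℝ) : valueAt (mixedPoint Tᶜ q y) (treeProduct T
      (fun j l => (G.solCoeff T A j l : ℝ)) fun j => (solConst N T A j : ℝ)) =
      ((∏ j ∈ T, 1 / (G.solve N T (fun l => y l) j ^ 2 + q j ^ 2) : ℝ) : ℂ) := by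
    have hmem (j) (hj : j ∈ T) : treeFactor Tᶜ (fun l => (G.solCoeff T A j l : ℝ))
        (solConst N T A j : ℝ) j ∈ denomAlgebra Finset.univ Tᶜ :=
      treeFactor_mem (by simpa using hj) (Finset.mem_univ j) (by simp) _
    have hprod : ∀ S ⊆ T, valueAt (mixedPoint Tᶜ q y) (∏ j ∈ S, treeFactor Tᶜ
        (fun l => (G.solCoeff T A j l : ℝ)) (solConst N T A j : ℝ) j) =
        ((∏ j ∈ S, 1 / (G.solve N T (fun l => y l) j ^ 2 + q j ^ 2) : ℝ) : ℂ) := by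
      intro S
      induction S using Finset.induction_on with
      | empty =>
        intro _
        simpa using (HasValueAt.algebraMap (p := mixedPoint Tᶜ q y) (1 : ℂ)).valueAt_eq
      | insert j S hj ih =>
        intro hS
        rw [Finset.insert_subset_iff] at hS
        rw [Finset.prod_insert hj, valueAt_mul hq y (hmem j hS.1)
          (prod_mem fun i hi => hmem i (hS.2 hi)), ih hS.2, valueAt_treeFactor (by simpa using hS.1)
          _ hq, Finset.prod_insert hj, Complex.ofReal_mul, solve_eq hG hN hT hA,
          Finset.sum_subtype (F := inferInstance) Tᶜ (p := fun e => e ∉ T) (by simp)]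
    exact hprod T (Finset.Subset.refl T)
  rw [cauchyMean]
  simp_rw [hval]
  have hc : Continuous fun y : {e // e ∉ T} → ℝ =>
      ((∏ j ∈ T, 1 / (G.solve N T y j ^ 2 + q j ^ 2) : ℝ) : ℂ) :=
    Complex.continuous_ofReal.comp (continuous_treePart hG hN hT hq)
  -- The mean runs over coordinates for all lines; those of tree lines are idle and integrate to
  -- one.
  rw [integral_pi_restrict _ (fun e => e ∉ T) hc,
    Finset.prod_subtype (F := inferInstance) Tᶜ (p := fun e => e ∉ T) (by simp)
      (fun l => ((Real.pi / q l : ℝ) : ℂ)),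
    integral_pi_cauchyLaw (q := fun l : {e // e ∉ T} => q l) (fun l => hq l), matsubaraIntegral,
    ← integral_complex_ofReal]
  refine integral_congr_ae (Filter.Eventually.of_forall fun y => ?_)
  simp only
  rw [integrand_eq hG hN hT, Complex.ofReal_mul, Complex.ofReal_prod (s := Finset.univ)]

end OrientedMultigraph

/-! ### Rational functions determined by their values on the positive orthant. -/

section Agreement

variable {E : Type*} [Fintype E] [DecidableEq E]

/-- The cross-multiplied polynomials agree on a product of infinite sets, hence are equal. -/
theorem AgreesOnPositive.unique {F F' : LineRatFunc E} {f : (E → ℝ) → ℝ}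
    (h : AgreesOnPositive F f) (h' : AgreesOnPositive F' f) : F = F' := by
  obtain ⟨P, Q, hQ, rfl⟩ := IsFractionRing.div_surjective (A := MvPolynomial E ℂ) F
  obtain ⟨P', Q', hQ', rfl⟩ := IsFractionRing.div_surjective (A := MvPolynomial E ℂ) F'
  have hQ0 := nonZeroDivisors.ne_zero hQ
  have hQ0' := nonZeroDivisors.ne_zero hQ'
  have key : P * Q' = P' * Q := by
    have hinf : ((fun r : ℝ => (r : ℂ)) '' Set.Ioi 0).Infinite :=
      (Set.Ioi_infinite (0 : ℝ)).image Complex.ofReal_injective.injOn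
    refine MvPolynomial.funext_set (fun _ : E => (fun r : ℝ => (r : ℂ)) '' Set.Ioi 0)
      (fun _ => hinf) fun x hx => ?_
    choose q hq hqx using fun i => hx i (Set.mem_univ i)
    obtain rfl : (fun i => (q i : ℂ)) = x := funext hqx
    rw [map_mul, map_mul, ← h P Q hQ0 rfl q hq, ← h' P' Q' hQ0' rfl q hq]
    ring
  have hA : algebraMap (MvPolynomial E ℂ) (LineRatFunc E) Q ≠ 0 := by
    simpa using hQ0
  have hA' : algebraMap (MvPolynomial E ℂ) (LineRatFunc E) Q' ≠ 0 := by
    simpa using hQ0'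
  rw [div_eq_div_iff hA hA', ← map_mul, key, map_mul]

theorem agreesOnPositive_of_valueAt {F : LineRatFunc E} (hF : F ∈ denomAlgebra Finset.univ ∅)
    {f : (E → ℝ) → ℝ}
    (h : ∀ q : E → ℝ, (∀ i, 0 < q i) → (f q : ℂ) = valueAt (fun i => (q i : ℂ)) F) :
    AgreesOnPositive F f := by
  intro P Q hQ hFPQ q hq
  have hv := hasValueAt_of_mem hq 0 hF
  rw [mixedPoint_empty, ← h q hq] at hv
  have hA : algebraMap (MvPolynomial E ℂ) (LineRatFunc E) Q ≠ 0 := by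
    simpa using hQ
  have h1 := hv.mul (HasValueAt.of_poly Q)
  have h2 : F * polyToRat Q = polyToRat P := by
    rw [hFPQ]
    exact div_mul_cancel₀ _ hA
  rw [h2] at h1
  rw [mul_comm]
  exact h1.unique (HasValueAt.of_poly P)

theorem cutOperator_eq_zero_of_subset {C C' : Finset E} (h : C' ⊆ C) {F : LineRatFunc E}
    (hF : cutOperator C' F = 0) : cutOperator C F = 0 := by
  rw [← Finset.sdiff_union_of_subset h]
  generalize C \ C' = D
  induction D using Finset.induction_on with
  | empty => rwa [Finset.empty_union]
  | insert l D _ ih =>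
    rw [Finset.insert_union]
    by_cases hl : l ∈ D ∪ C'
    · rwa [Finset.insert_eq_of_mem hl]
    · rw [cutOperator_insert hl, Module.End.mul_apply, ih, map_zero]

end Agreement

/-! ### Existence and uniqueness of the evaluation, and its annihilation by cutsets. -/

namespace OrientedMultigraph

variable {V E : Type*} [Fintype V] [DecidableEq V] [Fintype E] [DecidableEq E]
  {G : OrientedMultigraph V E} {N : V → ℤ}

theorem IsMatsubara.exists_isEvaluation (hG : G.IsMatsubara) (hN : ∑ v, N v = 0) :
    ∃ F : LineRatFunc E, G.IsEvaluation N F := by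
  obtain ⟨T, -, hT⟩ := exists_isSpanningTree hG.connected
  obtain ⟨A, hA⟩ := hT.exists_cuts hG.loopless
  obtain ⟨F, hF, hv⟩ := exists_evaluation T (fun j l => (G.solCoeff T A j l : ℝ))
    fun j => (solConst N T A j : ℝ)
  refine ⟨F, fun T' hT' => agreesOnPositive_of_valueAt hF fun q hq => ?_⟩
  rw [matsubaraIntegral_eq hG.loopless hN hT' hT,
    matsubaraIntegral_eq_cauchyMean hG.loopless hN hT hA hq, hv q hq]

theorem IsMatsubara.evaluation_unique (hG : G.IsMatsubara) {F F' : LineRatFunc E}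
    (hF : G.IsEvaluation N F) (hF' : G.IsEvaluation N F') : F = F' := by
  obtain ⟨T, -, hT⟩ := exists_isSpanningTree hG.connected
  exact (hF T hT).unique (hF' T hT)

/-- A minimal cutset contained in `C`, with a spanning tree that meets it in a single line. -/
theorem IsCutset.exists_tree (hG : G.IsMatsubara) {C : Finset E} (hC : G.IsCutset C) :
    ∃ (K T : Finset E) (c : E), insert c K ⊆ C ∧ c ∈ T ∧ Disjoint T K ∧
      G.IsCutset (insert c K) ∧ G.IsSpanningTree T := by
  obtain ⟨C', hC', hmin⟩ := exists_minimal_le_of_wellFoundedLT G.IsCutset C hC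
  obtain ⟨c, hc⟩ : C'.Nonempty := by
    rw [Finset.nonempty_iff_ne_empty]
    rintro rfl
    exact hmin.prop (by simpa using hG.connected)
  -- By minimality, restoring `c` reconnects the graph, so some spanning tree avoids the rest of the
  -- cutset. It must contain `c`, since otherwise it would avoid the whole cutset.
  have hconn : (G.spanned (C'.erase c)ᶜ).Connected := by
    by_contra h
    exact Finset.notMem_erase c C' (hmin.le_of_le h (Finset.erase_subset _ _) hc)
  obtain ⟨T, hTS, hT⟩ := exists_isSpanningTree hconn
  have hdisj : Disjoint T (C'.erase c) := Finset.disjoint_left.2 fun e he =>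
    Finset.mem_compl.1 (hTS he)
  refine ⟨C'.erase c, T, c, ?_, ?_, hdisj, ?_, hT⟩
  · rwa [Finset.insert_erase hc]
  · by_contra hcT
    refine hmin.prop (hT.isTree.connected.mono (spanned_mono fun e he => Finset.mem_compl.2 fun h => ?_))
    by_cases hec : e = c
    · exact hcT (hec ▸ he)
    · exact Finset.disjoint_left.1 hdisj he (Finset.mem_erase.2 ⟨hec, h⟩)
  · rw [Finset.insert_erase hc]
    exact hmin.prop

theorem IsCutset.cutOperator_evaluation (hG : G.IsMatsubara) (hN : ∑ v, N v = 0) {C : Finset E}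
    (hC : G.IsCutset C) {F : LineRatFunc E} (hF : G.IsEvaluation N F) : cutOperator C F = 0 := by
  obtain ⟨K, T, c, hKC, hcT, hTK, hcut, hT⟩ := hC.exists_tree hG
  refine cutOperator_eq_zero_of_subset hKC ?_
  obtain ⟨A₀, hA₀⟩ := hT.exists_cuts hG.loopless
  -- The cut for `c` comes from the graph without the cutset, so every line crossing it lies in the
  -- cutset. Hence the coefficients of `x_c` vanish outside `K`; the other tree lines may use any
  -- fundamental cut.
  obtain ⟨B, hB, hB'⟩ := exists_isFundamentalCut_of_not_connected hT.isTree.connected (j := c)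
    (S := (insert c K)ᶜ) (fun e he => by
      obtain ⟨hne, heT⟩ := Finset.mem_erase.1 he
      rw [Finset.mem_compl, Finset.mem_insert, not_or]
      exact ⟨hne, Finset.disjoint_left.1 hTK heT⟩) hcut
  set A := Function.update A₀ c B with hAdef
  have hA : ∀ j ∈ T, G.IsFundamentalCut T j (A j) := by
    intro j hj
    by_cases h : j = c
    · subst h
      rwa [hAdef, Function.update_self]
    · rw [hAdef, Function.update_of_ne h]
      exact hA₀ j hj
  obtain ⟨F', hF', hv, hzero⟩ := exists_evaluation_cutOperator_eq_zero hcT hTK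
    (fun j l => (G.solCoeff T A j l : ℝ)) (fun j => (solConst N T A j : ℝ)) (by
      intro l hlT hlK
      have hlc : l ≠ c := by
        rintro rfl
        exact hlT hcT
      have := hB' l (by simp [hlc, hlK])
      by_cases h : G.tgt l ∈ B <;> simp [solCoeff, hcT, hAdef, cutCoeff, this, h])
  have hagree : AgreesOnPositive F' (G.matsubaraIntegral N T) :=
    agreesOnPositive_of_valueAt hF' fun q hq => by
      rw [matsubaraIntegral_eq_cauchyMean hG.loopless hN hT hA hq, hv q hq]
  rwa [(hF T hT).unique hagree]

end OrientedMultigraph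

end

theorem mainTheorem3 {V E : Type*} [Fintype V] [DecidableEq V] [Fintype E] [DecidableEq E]
    (G : OrientedMultigraph V E) (hG : G.IsMatsubara)
    (N : V → ℤ) (hN : ∑ v, N v = 0) :
    (∀ T : Finset E, G.IsSpanningTree T →
      (∀ y : {e // e ∉ T} → ℝ,
        ∃! x : E → ℝ, G.Conserves N x ∧ ∀ l : {e // e ∉ T}, x l = y l) ∧
      ∀ q : E → ℝ, (∀ i, 0 < q i) → MeasureTheory.Integrable (G.integrand N T q)) ∧
    (∃! F : LineRatFunc E, G.IsEvaluation N F) ∧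
    ∀ C : Finset E, G.IsCutset C →
      ∀ F : LineRatFunc E, G.IsEvaluation N F → cutOperator C F = 0 := by
  refine ⟨fun T hT => ⟨OrientedMultigraph.existsUnique_conserves hG.loopless hN hT, fun q hq =>
    OrientedMultigraph.integrable_integrand hG.loopless hN hT hq⟩, ?_, fun C hC F hF =>
    hC.cutOperator_evaluation hG hN hF⟩
  obtain ⟨F, hF⟩ := hG.exists_isEvaluation hN
  exact ⟨F, hF, fun F' hF' => hG.evaluation_unique hF' hF⟩
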